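/- Let $K$ be a partially ordered set. For $a\le b$ let $(a,b)$ be the elementary path from $b$ to $a$ and $\overline{(b,a)}$ the elementary path from $a$ to $b$, with $(a,a)=\overline{(a,a)}=i_a$. Let $\sim$ be the congruence on sequences $\overline p=s_n*\dots*s_1$ of composable elementary paths generated by $(a,b)*(b,c)\sim(a,c)$, $\overline{(c,b)}*\overline{(b,a)}\sim\overline{(c,a)}$, $(a,b)*\overline{(b,a)}\sim i_a$, $\overline{(b,a)}*(a,b)\sim i_b$ ($a\le b\le c$). Classes of sequences are called paths, $S_a$ is the set of paths ending at $a$, and $G_a\cong\pi_1(K)$ is the group of classes of loops at $a$. $K$ is path connected if any two points are joined by a path. An order preserving map $\varphi:K\to L$ acts on sequences and induces homomorphisms $\varphi^*:G_a\to G_{\varphi(a)}$. A net of Hilbert spaces over $K$ consists of complex Hilbert spaces $H_a$ and linear isometries $\gamma_{ba}:H_a\to H_b$ ($a\le b$) with $\gamma_{aa}=\mathrm{id}$ and $\gamma_{ca}=\gamma_{cb}\gamma_{ba}$. On $\mathcal H=\bigoplus_{a\in K}H_a\otimes l^2(S_a)$ let $\chi_a^b$ ($a\le b$) be the operator with $\chi_a^b(h\otimes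 e_p)=\gamma_{ba}(h)\otimes e_{[\overline{(b,a)}]*p}$ on $H_a\otimes l^2(S_a)$ and $0$ on the other summands. Put $\chi_{\overline{(b,a)}}=\chi_a^b$, $\chi_{(a,b)}=(\chi_a^b)^*$ and $\chi_{\overline p}=\chi_{s_n}\cdots\chi_{s_1}$. For $p\in G_a$ let $\mathfrak A_{a,p}$ be the strongly closed linear span of $\{\chi_{\overline p}:\overline p\in p\}$. (For $p=[i_a]$ this is the strongly closed algebra $\mathfrak A_{a,e}$ generated by the trivial cycles, and $\mathfrak A_{a,p}=\mathfrak A_{a,e}\chi_p$ whenever the cycles $\chi_{\overline p}$, $\overline p\in p$, are partial isometries with join $\chi_p=\bigvee_{\overline p\in p}\chi_{\overline p}$.) Let $\mathfrak A_a$ be the $C^*$-algebra generated by all $\mathfrak A_{a,p}$, $p\in G_a$, and let $\alpha_{ba}:\mathfrak A_a\to\mathfrak A_b$, $\alpha_{ba}(A)=\chi_a^bA\chi_a^{b*}$ ($a\le b$). Then $(K,\mathfrak A_a,\alpha_{ba})$ is a net of $C^*$-algebras: the $\alpha_{ba}$ are injective $*$-homomorphisms, $\alpha_{aa}=\mathrm{id}$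 and $\alpha_{ca}=\alpha_{cb}\alpha_{ba}$. A morphism $(\varphi,\Phi)$ of nets of Hilbert spaces from $(K,H^K_a,\gamma_{ba})$ to $(L,H^L_x,\gamma_{yx})$ is an order preserving map $\varphi:K\to L$ with a linear isometry $\Phi:\bigoplus_{a}H^K_a\to\bigoplus_{x}H^L_x$ restricting to isometries $\Phi_a:H^K_a\to H^L_{\varphi(a)}$ such that $\Phi_b\gamma_{ba}=\gamma_{\varphi(b)\varphi(a)}\Phi_a$ for $a\le b$. A morphism of nets of $C^*$-algebras over $\varphi$ is a family of $*$-homomorphisms $\Psi_a:\mathfrak A^K_a\to\mathfrak A^L_{\varphi(a)}$ with $\Psi_b\alpha_{ba}=\alpha_{\varphi(b)\varphi(a)}\Psi_a$ for $a\le b$; it is faithful if every $\Psi_a$ is injective. **Theorem.** Let $(\varphi,\Phi)$ be a morphism of nets of Hilbert spaces from $(K,H^K_a,\gamma_{ba})$ to $(L,H^L_x,\gamma_{yx})$, where $K$ is path connected. Suppose that every $\Phi_a:H^K_a\to H^L_{\varphi(a)}$ is an isometric isomorphism and that $\varphi^*:\pi_1(K)\to\pi_1(L)$ is injective (that is, $\varphi^*:G_{a_0}\to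 G_{\varphi(a_0)}$ is injective for some base point $a_0\in K$). Then $(\varphi,\Phi)$ induces a faithful morphism $(\varphi,\Phi^*)$ from $(K,\mathfrak A^K_a,\alpha_{ba})$ to $(L,\mathfrak A^L_x,\alpha_{yx})$: there are injective $*$-homomorphisms $\Phi^*_a:\mathfrak A^K_a\to\mathfrak A^L_{\varphi(a)}$, $a\in K$, with $\Phi^*_b\alpha_{ba}=\alpha_{\varphi(b)\varphi(a)}\Phi^*_a$ for $a\le b$, such that $\Phi^*_a(\chi_{\overline p})=\chi_{\varphi(\overline p)}$ for every loop $\overline p$ at $a$, $\Phi^*_a(\mathfrak A^K_{a,p})\subseteq\mathfrak A^L_{\varphi(a),\varphi^*(p)}$ for every $p\in G_a$, and $\Phi^*_a$ is strongly continuous on bounded subsets of each $\mathfrak A^K_{a,p}$. -/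

import Mathlib

open scoped ENNReal InnerProductSpace Topology

universe u u' v v'

namespace PosetNet

/-! ## Paths on a partially ordered set -/

/-- Elementary paths: `Elem a b` is the set of elementary paths with starting point `a` and ending
point `b`.  For `a ≤ b` the path `down` is the pair `(a, b)`, which starts at `b` and ends at `a`,
and `up` is the pair `(b, a)` with a bar, which starts at `a` and ends at `b`. -/
inductive Elem {K : Type u} [PartialOrder K] : K → K → Type u
  | down {a b : K} (h : a ≤ b) : Elem b a
  | up {a b : K} (h : a ≤ b) : Elem a b

/-- The reverse elementary path. -/
def Elem.inv {K : Type u} [PartialOrder K] {a b : K} : Elem a b → Elem b a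
  | .down h => .up h
  | .up h => .down h

/-- Sequences `sₙ * ⋯ * s₁`, `n ≥ 1`, of composable elementary paths, with starting point `a` and
ending point `b`. -/
inductive Seq {K : Type u} [PartialOrder K] : K → K → Type u
  | single {a b : K} (s : Elem a b) : Seq a b
  | cons {a b c : K} (s : Elem b c) (p : Seq a b) : Seq a c

namespace Seq

variable {K : Type u} [PartialOrder K] {L : Type v} [PartialOrder L]

/-- The product `p * q`: first `q`, then `p`. -/
def comp {a b c : K} : Seq b c → Seq a b → Seq a c
  | single s, q => cons s q
  | cons s p, q => cons s (p.comp q)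

/-- The reverse sequence. -/
def inv {a b : K} : Seq a b → Seq b a
  | single s => single s.inv
  | cons s p => p.inv.comp (single s.inv)

/-- The trivial path `i_a = (a, a)`. -/
def triv (a : K) : Seq a a := single (.down le_rfl)

/-- The elementary path `(a, b)` as a sequence. -/
def dn {a b : K} (h : a ≤ b) : Seq b a := single (.down h)

/-- The elementary path `(b, a)` with a bar as a sequence. -/
def up {a b : K} (h : a ≤ b) : Seq a b := single (.up h)

/-- The equivalence of sequences: one is obtained from the other by finitely many replacements of
sub-sequences according to the four basic relations.  (`up_refl` is the convention that `(a, a)`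
with and without a bar are the same trivial path.) -/
inductive Rel : {a b : K} → Seq a b → Seq a b → Prop
  | dn_dn {a b c : K} (h : a ≤ b) (k : b ≤ c) : Rel ((dn h).comp (dn k)) (dn (h.trans k))
  | up_up {a b c : K} (h : a ≤ b) (k : b ≤ c) : Rel ((up k).comp (up h)) (up (h.trans k))
  | dn_up {a b : K} (h : a ≤ b) : Rel ((dn h).comp (up h)) (triv a)
  | up_dn {a b : K} (h : a ≤ b) : Rel ((up h).comp (dn h)) (triv b)
  | up_refl (a : K) : Rel (up (le_refl a)) (triv a)
  | refl {a b : K} (p : Seq a b) : Rel p p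
  | symm {a b : K} {p q : Seq a b} : Rel p q → Rel q p
  | trans {a b : K} {p q r : Seq a b} : Rel p q → Rel q r → Rel p r
  | comp {a b c : K} {p p' : Seq b c} {q q' : Seq a b} :
      Rel p p' → Rel q q' → Rel (p.comp q) (p'.comp q')

theorem comp_assoc {a b c d : K} (p : Seq c d) (q : Seq b c) (r : Seq a b) :
    (p.comp q).comp r = p.comp (q.comp r) := by
  induction p with
  | single s => rfl
  | cons s p ih => simp only [comp, ih]

theorem triv_comp {a b : K} (p : Seq a b) : Rel ((triv b).comp p) p := by
  have key : ∀ {x y : K} (s : Elem x y), Rel ((triv y).comp (single s)) (single s) := by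
    intro x y s
    cases s with
    | down h => exact Rel.dn_dn le_rfl h
    | up h =>
      exact ((Rel.up_refl _).symm.comp (Rel.refl _)).trans (Rel.up_up h le_rfl)
  cases p with
  | single s => exact key s
  | cons s p => exact (key s).comp (Rel.refl p)

theorem single_comp_triv {x y : K} (s : Elem x y) :
    Rel ((single s).comp (triv x)) (single s) := by
  cases s with
  | down h => exact Rel.dn_dn h le_rfl
  | up h => exact ((Rel.refl _).comp (Rel.up_refl _).symm).trans (Rel.up_up le_rfl h)

theorem comp_triv {a b : K} (p : Seq a b) : Rel (p.comp (triv a)) p := by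
  induction p with
  | single s => exact single_comp_triv s
  | cons s p ih => exact (Rel.refl (single s)).comp ih

theorem single_inv_comp {x y : K} (s : Elem x y) :
    Rel ((single s.inv).comp (single s)) (triv x) := by
  cases s with
  | down h => exact Rel.up_dn h
  | up h => exact Rel.dn_up h

theorem inv_comp {a b : K} (p : Seq a b) : Rel (p.inv.comp p) (triv a) := by
  induction p with
  | single s => exact single_inv_comp s
  | cons s p ih =>
    have h : ((cons s p).inv).comp (cons s p)
        = p.inv.comp (((single s.inv).comp (single s)).comp p) := comp_assoc _ _ _
    rw [h]
    exact ((Rel.refl _).comp (((single_inv_comp s).comp (Rel.refl p)).trans (triv_comp p))).trans ih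

theorem single_comp_inv {x y : K} (s : Elem x y) :
    Rel ((single s).comp (single s.inv)) (triv y) := by
  cases s with
  | down h => exact Rel.dn_up h
  | up h => exact Rel.up_dn h

theorem comp_inv {a b : K} (p : Seq a b) : Rel (p.comp p.inv) (triv b) := by
  induction p with
  | single s => exact single_comp_inv s
  | cons s p ih =>
    have h : (cons s p).comp (cons s p).inv
        = (single s).comp ((p.comp p.inv).comp (single s.inv)) := by
      rw [comp_assoc]; rfl
    rw [h]
    exact ((Rel.refl _).comp ((ih.comp (Rel.refl _)).trans (triv_comp _))).trans
      (single_comp_inv s)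

theorem Rel.inv {a b : K} {p q : Seq a b} (h : Rel p q) : Rel p.inv q.inv := by
  have h₁ : Rel (p.inv.comp (q.comp q.inv)) p.inv :=
    ((Rel.refl _).comp (comp_inv q)).trans (comp_triv _)
  have h₂ : Rel ((p.inv.comp q).comp q.inv) q.inv :=
    ((((Rel.refl _).comp h.symm).trans (inv_comp p)).comp (Rel.refl _)).trans (triv_comp _)
  rw [comp_assoc] at h₂
  exact h₁.symm.trans h₂

/-- The image of a sequence of elementary paths under a morphism of partially ordered sets. -/
def map (φ : K →o L) {a b : K} : Seq a b → Seq (φ a) (φ b)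
  | single (.down h) => dn (φ.monotone h)
  | single (.up h) => up (φ.monotone h)
  | cons (.down h) p => (dn (φ.monotone h)).comp (p.map φ)
  | cons (.up h) p => (up (φ.monotone h)).comp (p.map φ)

theorem map_comp (φ : K →o L) {a b c : K} (p : Seq b c) (q : Seq a b) :
    (p.comp q).map φ = (p.map φ).comp (q.map φ) := by
  induction p with
  | single s => cases s <;> rfl
  | cons s p ih => cases s <;> simp only [comp, map, ih, comp_assoc]

theorem Rel.map (φ : K →o L) {a b : K} {p q : Seq a b} (h : Rel p q) :
    Rel (p.map φ) (q.map φ) := by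
  induction h with
  | dn_dn h k => exact Rel.dn_dn _ _
  | up_up h k => exact Rel.up_up _ _
  | dn_up h => exact Rel.dn_up _
  | up_dn h => exact Rel.up_dn _
  | up_refl a => exact Rel.up_refl _
  | refl p => exact Rel.refl _
  | symm _ ih => exact ih.symm
  | trans _ _ ih₁ ih₂ => exact ih₁.trans ih₂
  | comp _ _ ih₁ ih₂ => rw [map_comp, map_comp]; exact ih₁.comp ih₂

instance setoid (a b : K) : Setoid (Seq a b) :=
  ⟨Rel, Rel.refl, Rel.symm, Rel.trans⟩

end Seq

/-- Paths from `a` to `b`: equivalence classes of sequences of elementary paths. -/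
def Path {K : Type u} [PartialOrder K] (a b : K) : Type u := Quotient (Seq.setoid a b)

/-- The class `[p]` of a sequence. -/
def Seq.cls {K : Type u} [PartialOrder K] {a b : K} (p : Seq a b) : Path a b := Quotient.mk _ p

namespace Path

variable {K : Type u} [PartialOrder K] {L : Type v} [PartialOrder L]

/-- The product of paths, `[p] * [q] = [p * q]`. -/
def comp {a b c : K} : Path b c → Path a b → Path a c :=
  Quotient.map₂ Seq.comp fun _ _ h _ _ k => Seq.Rel.comp h k

/-- The inverse path. -/
def inv {a b : K} : Path a b → Path b a :=
  Quotient.map Seq.inv fun _ _ h => Seq.Rel.inv h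

/-- The map on paths induced by a morphism of partially ordered sets, `[p] ↦ [φ(p)]`. -/
def map (φ : K →o L) {a b : K} : Path a b → Path (φ a) (φ b) :=
  Quotient.map (Seq.map φ) fun _ _ h => Seq.Rel.map φ h

theorem comp_assoc {a b c d : K} (p : Path c d) (q : Path b c) (r : Path a b) :
    (p.comp q).comp r = p.comp (q.comp r) := by
  induction p using Quotient.inductionOn
  induction q using Quotient.inductionOn
  induction r using Quotient.inductionOn
  exact congrArg Seq.cls (Seq.comp_assoc _ _ _)

theorem triv_comp {a b : K} (p : Path a b) : (Seq.triv b).cls.comp p = p := by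
  induction p using Quotient.inductionOn
  exact Quotient.sound (Seq.triv_comp _)

theorem comp_triv {a b : K} (p : Path a b) : p.comp (Seq.triv a).cls = p := by
  induction p using Quotient.inductionOn
  exact Quotient.sound (Seq.comp_triv _)

end Path

/-- The group `G_a` of (classes of) loops with base point `a`, a model of `π₁(K)`
based at `a`. -/
def LoopGroup {K : Type u} [PartialOrder K] (a : K) : Type u := Path a a

noncomputable instance {K : Type u} [PartialOrder K] (a : K) : Group (LoopGroup a) where
  mul p q := Path.comp p q
  one := (Seq.triv a).cls
  inv p := Path.inv p
  mul_assoc p q r := Path.comp_assoc p q r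
  one_mul p := Path.triv_comp p
  mul_one p := Path.comp_triv p
  inv_mul_cancel p := by
    induction p using Quotient.inductionOn
    exact Quotient.sound (Seq.inv_comp _)

/-- The class of a loop. -/
def Seq.loopCls {K : Type u} [PartialOrder K] {a : K} (p : Seq a a) : LoopGroup a := p.cls

/-- The homomorphism `φ* : π₁(K) → π₁(L)` (with base points `a`, `φ a`), `[p] ↦ [φ(p)]`. -/
def piOneMap {K : Type u} [PartialOrder K] {L : Type v} [PartialOrder L] (φ : K →o L) (a : K) :
    LoopGroup a →* LoopGroup (φ a) where
  toFun p := Path.map φ p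
  map_one' := rfl
  map_mul' p q := by
    induction p using Quotient.inductionOn
    induction q using Quotient.inductionOn
    exact congrArg Seq.cls (Seq.map_comp φ _ _)

/-- `K` is path connected: any two points are joined by a path. -/
def PathConnected (K : Type u) [PartialOrder K] : Prop := ∀ a b : K, Nonempty (Path a b)

/-! ## Nets of Hilbert spaces and the operators `χ` -/

/-- A net of Hilbert spaces `(K, H_a, γ_{ba})_{a ≤ b}` over a partially ordered set `K`. -/
structure HilbertNet (K : Type u) [PartialOrder K] (H : K → Type v)
    [∀ a, NormedAddCommGroup (H a)] [∀ a, InnerProductSpace ℂ (H a)] where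
  /-- the isometric embedding `γ_{ba} : H_a → H_b` for `a ≤ b` -/
  γ : ∀ {a b : K}, a ≤ b → H a →ₗᵢ[ℂ] H b
  γ_refl : ∀ (a : K) (x : H a), γ (le_refl a) x = x
  γ_comp : ∀ {a b c : K} (h : a ≤ b) (k : b ≤ c) (x : H a), γ (h.trans k) x = γ k (γ h x)

/-- The set `S_a` of all paths with ending point `a`. -/
def PathsTo {K : Type u} [PartialOrder K] (a : K) : Type u := Σ c : K, Path c a

/-- The bijection `S_b → S_a`, `q ↦ [(a, b) * q]`, for `a ≤ b`.  Its inverse is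
left multiplication by `(b, a)` with a bar. -/
def PathsTo.shift {K : Type u} [PartialOrder K] {a b : K} (h : a ≤ b) : PathsTo b ≃ PathsTo a where
  toFun q := ⟨q.1, (Seq.dn h).cls.comp q.2⟩
  invFun p := ⟨p.1, (Seq.up h).cls.comp p.2⟩
  left_inv q := by
    obtain ⟨c, q⟩ := q
    have e : (Seq.up h).cls.comp (Seq.dn h).cls = (Seq.triv b).cls :=
      Quotient.sound (Seq.Rel.up_dn h)
    simp only [← Path.comp_assoc, e, Path.triv_comp]; rfl
  right_inv p := by
    obtain ⟨c, p⟩ := p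
    have e : (Seq.dn h).cls.comp (Seq.up h).cls = (Seq.triv a).cls :=
      Quotient.sound (Seq.Rel.dn_up h)
    simp only [← Path.comp_assoc, e, Path.triv_comp]; rfl

section Operators

variable {K : Type u} [PartialOrder K] (H : K → Type v)
  [∀ a, NormedAddCommGroup (H a)] [∀ a, InnerProductSpace ℂ (H a)]

/-- The Hilbert space `H_a ⊗ l²(S_a)`, realized as the space `l²(S_a; H_a)` of square summable
`H_a`-valued functions on `S_a`; the vector `h ⊗ e_p` is `lp.single 2 p h`. -/
abbrev Fiber (a : K) : Type (max u v) := lp (fun _ : PathsTo a => H a) 2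

/-- The Hilbert space `⊕_{a ∈ K} H_a ⊗ l²(S_a)`. -/
abbrev TotalSpace : Type (max u v) := lp (fun a : K => Fiber H a) 2

/-- The bounded operators on `⊕_{a ∈ K} H_a ⊗ l²(S_a)`. -/
abbrev Op : Type (max u v) := TotalSpace H →L[ℂ] TotalSpace H

open Classical in
/-- The inclusion of the summand `H_a ⊗ l²(S_a)`. -/
noncomputable def incl (a : K) : Fiber H a →L[ℂ] TotalSpace H :=
  lp.singleContinuousLinearMap ℂ (fun a : K => Fiber H a) 2 a

/-- The projection onto the summand `H_a ⊗ l²(S_a)`. -/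
noncomputable def proj (a : K) : TotalSpace H →L[ℂ] Fiber H a :=
  lp.evalCLM ℂ (fun a : K => Fiber H a) 2 a

end Operators

section Cycles

variable {K : Type u} [PartialOrder K] {H : K → Type v}
  [∀ a, NormedAddCommGroup (H a)] [∀ a, InnerProductSpace ℂ (H a)]

theorem two_rpow_norm {α : Type*} {E : Type*} [NormedAddCommGroup E]
    (f : lp (fun _ : α => E) 2) : ‖f‖ ^ (2 : ℝ) = ∑' i, ‖f i‖ ^ (2 : ℝ) := by
  have := lp.norm_rpow_eq_tsum (p := 2) (by norm_num) f
  simpa using this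

/-- For `a ≤ b`, the isometry `H_a ⊗ l²(S_a) → H_b ⊗ l²(S_b)`,
`h ⊗ e_p ↦ γ_{ba}(h) ⊗ e_{[(b,a) * p]}` with a bar over `(b, a)`; as a map of functions it sends `f`
to `q ↦ γ_{ba} (f [(a, b) * q])`. -/
noncomputable def HilbertNet.fiberMap (N : HilbertNet K H) {a b : K} (h : a ≤ b) :
    Fiber H a →ₗᵢ[ℂ] Fiber H b where
  toFun f := ⟨fun q => N.γ h (f (PathsTo.shift h q)), by
    have hf := (lp.memℓp f).summable (p := 2) (by norm_num)
    refine memℓp_gen ?_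
    simp only [LinearIsometry.norm_map]
    exact (Equiv.summable_iff (PathsTo.shift h)).2 hf⟩
  map_add' f g := by
    apply lp.ext; funext q
    exact map_add (N.γ h) _ _
  map_smul' c f := by
    apply lp.ext; funext q
    exact map_smul (N.γ h) c _
  norm_map' f := by
    refine (Real.rpow_left_inj (norm_nonneg _) (norm_nonneg _) (two_ne_zero)).1 ?_
    rw [two_rpow_norm, two_rpow_norm]
    have : ∀ q, ‖N.γ h (f (PathsTo.shift h q))‖ ^ (2 : ℝ)
        = ‖f (PathsTo.shift h q)‖ ^ (2 : ℝ) := fun q => by rw [LinearIsometry.norm_map]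
    exact (tsum_congr this).trans (Equiv.tsum_eq (PathsTo.shift h) fun q => ‖f q‖ ^ (2 : ℝ))

/-- The partial isometry `χ_a^b` for `a ≤ b`: on the summand `H_a ⊗ l²(S_a)` it is
`h ⊗ e_p ↦ γ_{ba}(h) ⊗ e_{[(b,a) * p]}` (bar over `(b, a)`), and it vanishes on the other
summands. -/
noncomputable def HilbertNet.chi (N : HilbertNet K H) {a b : K} (h : a ≤ b) : Op H :=
  incl H b ∘L (N.fiberMap h).toContinuousLinearMap ∘L proj H a

variable [∀ a, CompleteSpace (H a)]

/-- The operator of an elementary path: `χ_a^b` for `(b, a)` with a bar, and its adjoint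
for `(a, b)`. -/
noncomputable def HilbertNet.chiElem (N : HilbertNet K H) {a b : K} : Elem a b → Op H
  | .down h => star (N.chi h)
  | .up h => N.chi h

/-- The operator `χ_p` of a sequence `p = sₙ * ⋯ * s₁`: the product of the operators of the
elementary paths `sₙ, …, s₁`.  If `p` is a loop it is called a cycle. -/
noncomputable def HilbertNet.chiSeq (N : HilbertNet K H) {a b : K} : Seq a b → Op H
  | .single s => N.chiElem s
  | .cons s p => N.chiElem s * N.chiSeq p

end Cycles

/-! ## The local `C*`-algebras -/

/-- The closure of a set of bounded operators in the strong operator topology. -/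
def strongClosure {E : Type v} [NormedAddCommGroup E] [InnerProductSpace ℂ E]
    (s : Set (E →L[ℂ] E)) : Set (E →L[ℂ] E) :=
  ContinuousLinearMap.toPointwiseConvergenceCLM ℂ (RingHom.id ℂ) E E ⁻¹'
    closure (ContinuousLinearMap.toPointwiseConvergenceCLM ℂ (RingHom.id ℂ) E E '' s)

theorem subset_strongClosure {E : Type v} [NormedAddCommGroup E] [InnerProductSpace ℂ E]
    (s : Set (E →L[ℂ] E)) : s ⊆ strongClosure s :=
  (Set.subset_preimage_image _ s).trans (Set.preimage_mono subset_closure)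

/-- Two-sided multiplication by fixed operators is continuous for the strong operator topology. -/
theorem mul_mem_strongClosure {E : Type v} [NormedAddCommGroup E] [InnerProductSpace ℂ E]
    {s t : Set (E →L[ℂ] E)} (A B : E →L[ℂ] E) (h : ∀ T ∈ s, A * T * B ∈ strongClosure t)
    {T : E →L[ℂ] E} (hT : T ∈ strongClosure s) : A * T * B ∈ strongClosure t := by
  have hc : Continuous fun T : E →Lₚₜ[ℂ] E =>
      PointwiseConvergenceCLM.postcomp E A (PointwiseConvergenceCLM.precomp E B T) :=
    (PointwiseConvergenceCLM.postcomp E A).continuous.comp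
      (PointwiseConvergenceCLM.precomp E B).continuous
  have := map_mem_closure hc hT (t := closure
    (ContinuousLinearMap.toPointwiseConvergenceCLM ℂ (RingHom.id ℂ) E E '' t)) (by
      rintro _ ⟨S, hS, rfl⟩
      exact h S hS)
  rw [closure_closure] at this
  exact this

theorem mul_eq_of_mem_strongClosure {E : Type v} [NormedAddCommGroup E] [InnerProductSpace ℂ E]
    {s : Set (E →L[ℂ] E)} (A B : E →L[ℂ] E) (h : ∀ T ∈ s, A * T * B = T)
    {T : E →L[ℂ] E} (hT : T ∈ strongClosure s) : A * T * B = T := by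
  have hc : Continuous fun T : E →Lₚₜ[ℂ] E =>
      PointwiseConvergenceCLM.postcomp E A (PointwiseConvergenceCLM.precomp E B T) :=
    (PointwiseConvergenceCLM.postcomp E A).continuous.comp
      (PointwiseConvergenceCLM.precomp E B).continuous
  refine closure_minimal (t := {T : E →Lₚₜ[ℂ] E |
    PointwiseConvergenceCLM.postcomp E A (PointwiseConvergenceCLM.precomp E B T) = T})
    ?_ (isClosed_eq hc continuous_id) hT
  rintro _ ⟨S, hS, rfl⟩
  exact h S hS

theorem partialIsometry_aux {A : Type v} [CStarAlgebra A] {X Y : A}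
    (hX : X * star X * X = X) (hY : Y * star Y * Y = Y) (h : X * (star Y * Y) = Y) :
    Y * star X = Y * star Y ∧ Y * (star X * X) = Y := by
  have hY' : star Y * Y * star Y = star Y := by
    simpa [mul_assoc] using congrArg star hY
  have a₁ : X * star Y = Y * star Y := by
    calc X * star Y = X * (star Y * Y * star Y) := by rw [hY']
      _ = X * (star Y * Y) * star Y := by simp only [mul_assoc]
      _ = _ := by rw [h]
  have a₂ : Y * star X = Y * star Y := by simpa using congrArg star a₁
  refine ⟨a₂, ?_⟩
  have hP : star X * X * (star X * X) = star X * X := by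
    rw [mul_assoc, ← mul_assoc X, hX]
  have b₁ : Y * (star X * X) * star Y = Y * star Y := by
    rw [← mul_assoc Y, a₂, mul_assoc, a₁, ← mul_assoc, hY]
  have hZ : (Y - Y * (star X * X)) * star (Y - Y * (star X * X)) = 0 := by
    have e : star (Y - Y * (star X * X)) = star Y - star X * X * star Y := by
      simp only [star_sub, star_mul, star_star]
    have c₁ : Y * (star X * X * star Y) = Y * star Y := by rw [← mul_assoc, b₁]
    have c₂ : Y * (star X * X) * (star X * X * star Y) = Y * star Y := by
      rw [mul_assoc Y, ← mul_assoc (star X * X), hP, c₁]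
    rw [e, sub_mul, mul_sub, mul_sub, c₁, c₂, b₁, sub_self]
  exact (sub_eq_zero.1 ((CStarRing.mul_star_self_eq_zero_iff _).1 hZ)).symm

section Local

variable {K : Type u} [PartialOrder K] {H : K → Type v}
  [∀ a, NormedAddCommGroup (H a)] [∀ a, InnerProductSpace ℂ (H a)] [∀ a, CompleteSpace (H a)]

namespace HilbertNet

variable (N : HilbertNet K H)

set_option linter.unusedSectionVars false

/-- The algebra `𝔄_{a,e}`: the strongly closed algebra generated by the trivial cycles at `a`. -/
def unitPart (a : K) : Set (Op H) :=
  strongClosure (NonUnitalAlgebra.adjoin ℂ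
    {T : Op H | ∃ p : Seq a a, Seq.Rel p (Seq.triv a) ∧ N.chiSeq p = T} : Set (Op H))

/-- The cycles `χ_q` of the loops `q` in a given class `p ∈ G_a`. -/
def cycles (a : K) (p : LoopGroup a) : Set (Op H) :=
  {T : Op H | ∃ q : Seq a a, q.loopCls = p ∧ N.chiSeq q = T}

/-- The subspace `𝔄_{a,p}`, `p ∈ G_a`: the strongly closed linear span of the cycles of
the sequences in the class `p`.  See `gradedPart_one` and `gradedPart_eq_of_isPCycle`: it is
`𝔄_{a,e}` for `p = e`, and `𝔄_{a,e} χ_p` where `χ_p` is the join of the cycles of the class `p`. -/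
def gradedPart (a : K) (p : LoopGroup a) : Set (Op H) :=
  strongClosure (Submodule.span ℂ (N.cycles a p) : Set (Op H))

/-- The `C*`-algebra `𝔄_a`: the norm closed `*`-algebra generated by all `𝔄_{a,p}`, `p ∈ G_a`. -/
noncomputable def localAlgebra (a : K) : NonUnitalStarSubalgebra ℂ (Op H) :=
  (NonUnitalStarAlgebra.adjoin ℂ (⋃ p : LoopGroup a, N.gradedPart a p)).topologicalClosure

instance (a : K) : IsClosed (N.localAlgebra a : Set (Op H)) :=
  NonUnitalStarSubalgebra.isClosed_topologicalClosure _

theorem chiSeq_comp {a b c : K} (p : Seq b c) (q : Seq a b) :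
    N.chiSeq (p.comp q) = N.chiSeq p * N.chiSeq q := by
  induction p with
  | single s => rfl
  | cons s p ih => simp only [Seq.comp, chiSeq, ih, mul_assoc]

/-! ### The join of the cycles of a class -/

/-- The operators obtained from cycles of the class `p` by finitely many joins
`X ∨ Y = X + Y (Y*Y - X*X Y*Y)`. -/
inductive IsFiniteJoin {a : K} (p : LoopGroup a) : Op H → Prop
  | single (q : Seq a a) (hq : q.loopCls = p) : IsFiniteJoin p (N.chiSeq q)
  | join (X : Op H) (q : Seq a a) (hX : IsFiniteJoin p X) (hq : q.loopCls = p) :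
      IsFiniteJoin p (X + N.chiSeq q * (star (N.chiSeq q) * N.chiSeq q
        - star X * X * (star (N.chiSeq q) * N.chiSeq q)))

/-- `X` is the join `χ_p` of all cycles of the class `p`: a partial isometry that is a strong limit
of finite joins and dominates all cycles of the class. -/
def IsPCycle {a : K} (p : LoopGroup a) (X : Op H) : Prop :=
  X ∈ strongClosure {Y | N.IsFiniteJoin p Y} ∧ X * star X * X = X ∧
    ∀ q : Seq a a, q.loopCls = p → X * (star (N.chiSeq q) * N.chiSeq q) = N.chiSeq q

theorem star_chiElem {a b : K} (s : Elem a b) : star (N.chiElem s) = N.chiElem s.inv := by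
  cases s with
  | down h => exact star_star _
  | up h => rfl

theorem star_chiSeq {a b : K} (p : Seq a b) : star (N.chiSeq p) = N.chiSeq p.inv := by
  induction p with
  | single s => exact N.star_chiElem s
  | cons s p ih =>
    simp only [Seq.inv, chiSeq, chiSeq_comp, star_mul, ih, star_chiElem]

theorem span_mul {a : K} {p q : LoopGroup a} {S T : Op H}
    (hS : S ∈ Submodule.span ℂ (N.cycles a p)) (hT : T ∈ Submodule.span ℂ (N.cycles a q)) :
    S * T ∈ Submodule.span ℂ (N.cycles a (p * q)) := by
  have h := Submodule.mul_mem_mul hS hT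
  rw [Submodule.span_mul_span] at h
  refine Submodule.span_mono ?_ h
  rintro _ ⟨_, ⟨r, hr, rfl⟩, _, ⟨s, hs, rfl⟩, rfl⟩
  exact ⟨r.comp s, by rw [← hr, ← hs]; rfl, N.chiSeq_comp r s⟩

theorem span_star {a : K} {p : LoopGroup a} {T : Op H}
    (hT : T ∈ Submodule.span ℂ (N.cycles a p)) :
    star T ∈ Submodule.span ℂ (N.cycles a p⁻¹) := by
  induction hT using Submodule.span_induction with
  | mem x hx =>
    obtain ⟨q, hq, rfl⟩ := hx
    exact Submodule.subset_span ⟨q.inv, by rw [← hq]; rfl, (N.star_chiSeq q).symm⟩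
  | zero => rw [star_zero]; exact zero_mem _
  | add x y _ _ hx hy => rw [star_add]; exact add_mem hx hy
  | smul c x _ hx => rw [star_smul]; exact Submodule.smul_mem _ _ hx

theorem adjoin_trivial (a : K) :
    (NonUnitalAlgebra.adjoin ℂ
      {T : Op H | ∃ p : Seq a a, Seq.Rel p (Seq.triv a) ∧ N.chiSeq p = T} : Set (Op H))
      = Submodule.span ℂ (N.cycles a 1) := by
  have e : {T : Op H | ∃ p : Seq a a, Seq.Rel p (Seq.triv a) ∧ N.chiSeq p = T}
      = N.cycles a 1 := by
    ext T
    constructor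
    · rintro ⟨p, hp, rfl⟩
      exact ⟨p, Quotient.sound hp, rfl⟩
    · rintro ⟨p, hp, rfl⟩
      exact ⟨p, Quotient.exact hp, rfl⟩
  rw [e]
  apply subset_antisymm
  · intro T hT
    induction hT using NonUnitalAlgebra.adjoin_induction with
    | mem x hx => exact Submodule.subset_span hx
    | add x y _ _ hx hy => exact add_mem hx hy
    | zero => exact zero_mem _
    | mul x y _ _ hx hy => simpa using N.span_mul hx hy
    | smul r x _ hx => exact Submodule.smul_mem _ _ hx
  · have : Submodule.span ℂ (N.cycles a 1)
        ≤ (NonUnitalAlgebra.adjoin ℂ (N.cycles a 1)).toSubmodule :=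
      Submodule.span_le.2 (NonUnitalAlgebra.subset_adjoin ℂ)
    exact this

theorem gradedPart_one (a : K) : N.gradedPart a 1 = N.unitPart a := by
  rw [gradedPart, unitPart, adjoin_trivial]

theorem IsFiniteJoin.mem_span {a : K} {p : LoopGroup a} {X : Op H} (hX : N.IsFiniteJoin p X) :
    X ∈ Submodule.span ℂ (N.cycles a p) := by
  induction hX with
  | single q hq => exact Submodule.subset_span ⟨q, hq, rfl⟩
  | join X q _ hq ih =>
    have hq' : N.chiSeq q ∈ Submodule.span ℂ (N.cycles a p) :=
      Submodule.subset_span ⟨q, hq, rfl⟩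
    have h₁ := N.span_mul (N.span_star hq') hq'
    have h₂ := N.span_mul (N.span_mul (N.span_star ih) ih) h₁
    rw [inv_mul_cancel] at h₁ h₂
    rw [mul_one] at h₂
    have h₃ := N.span_mul hq' (sub_mem h₁ h₂)
    rw [mul_one] at h₃
    exact add_mem ih h₃

/-- If the cycles of the class `p` are partial isometries and have a join `χ_p`, then
`𝔄_{a,p} = 𝔄_{a,e} χ_p`. -/
theorem gradedPart_eq_of_isPCycle {a : K} {p : LoopGroup a} {X : Op H} (hX : N.IsPCycle p X)
    (hpi : ∀ q : Seq a a, q.loopCls = p →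
      N.chiSeq q * star (N.chiSeq q) * N.chiSeq q = N.chiSeq q) :
    N.gradedPart a p = (fun A => A * X) '' N.unitPart a := by
  obtain ⟨hX₁, hX₂, hX₃⟩ := hX
  rw [← gradedPart_one]
  apply subset_antisymm
  · intro T hT
    refine ⟨T * star X, ?_, ?_⟩
    · have h := mul_mem_strongClosure (t := (Submodule.span ℂ (N.cycles a 1) : Set (Op H)))
        1 (star X) (fun S hS => ?_) hT
      · rw [one_mul] at h; exact h
      · refine subset_strongClosure _ ?_
        rw [one_mul]
        induction hS using Submodule.span_induction with
        | mem x hx =>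
          obtain ⟨q, hq, rfl⟩ := hx
          rw [(partialIsometry_aux hX₂ (hpi q hq) (hX₃ q hq)).1]
          have hq' : N.chiSeq q ∈ Submodule.span ℂ (N.cycles a p) :=
            Submodule.subset_span ⟨q, hq, rfl⟩
          simpa using N.span_mul hq' (N.span_star hq')
        | zero => rw [zero_mul]; exact zero_mem _
        | add x y _ _ hx hy => rw [add_mul]; exact add_mem hx hy
        | smul c x _ hx => rw [smul_mul_assoc]; exact Submodule.smul_mem _ _ hx
    · have h := mul_eq_of_mem_strongClosure 1 (star X * X) (fun S hS => ?_) hT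
      · simpa [mul_assoc] using h
      · rw [one_mul]
        induction hS using Submodule.span_induction with
        | mem x hx =>
          obtain ⟨q, hq, rfl⟩ := hx
          exact (partialIsometry_aux hX₂ (hpi q hq) (hX₃ q hq)).2
        | zero => rw [zero_mul]
        | add x y _ _ hx hy => rw [add_mul, hx, hy]
        | smul c x _ hx => rw [smul_mul_assoc, hx]
  · rintro _ ⟨A, hA, rfl⟩
    have hXp : X ∈ N.gradedPart a p := by
      have h := mul_mem_strongClosure (t := (Submodule.span ℂ (N.cycles a p) : Set (Op H)))
        1 1 (fun S hS => subset_strongClosure _ ?_) hX₁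
      · rw [one_mul, mul_one] at h; exact h
      · simpa using IsFiniteJoin.mem_span N hS
    have h := mul_mem_strongClosure (t := (Submodule.span ℂ (N.cycles a p) : Set (Op H)))
      1 X (fun S hS => ?_) hA
    · rw [one_mul] at h; exact h
    · have h' := mul_mem_strongClosure (t := (Submodule.span ℂ (N.cycles a p) : Set (Op H)))
        S 1 (fun R hR => subset_strongClosure _ ?_) hXp
      · simpa using h'
      · simpa using N.span_mul hS hR

/-! ### The net of `C*`-algebras -/
/-! ### The net of `C*`-algebras -/

/-- The projection of `⊕ H_a ⊗ l²(S_a)` onto the summand at `a`, as an operator on the sum. -/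
noncomputable def summandProj (H : K → Type v) [∀ a, NormedAddCommGroup (H a)]
    [∀ a, InnerProductSpace ℂ (H a)] (a : K) : Op H := incl H a ∘L proj H a

theorem proj_incl (a : K) (x : Fiber H a) : proj H a (incl H a x) = x := by
  classical
  exact Eq.trans (by unfold incl; rfl) (lp.single_apply_self (E := fun a : K => Fiber H a) 2 a x)

theorem inner_incl (a : K) (x : Fiber H a) (f : TotalSpace H) :
    ⟪incl H a x, f⟫_ℂ = ⟪x, proj H a f⟫_ℂ := by
  classical
  exact Eq.trans (by unfold incl; rfl)
    (lp.inner_single_left (𝕜 := ℂ) (G := fun a : K => Fiber H a) a x f)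

theorem chi_apply {a b : K} (h : a ≤ b) (f : TotalSpace H) :
    N.chi h f = incl H b (N.fiberMap h (proj H a f)) := rfl

theorem fiberMap_apply {a b : K} (h : a ≤ b) (f : Fiber H a) (q : PathsTo b) :
    N.fiberMap h f q = N.γ h (f (PathsTo.shift h q)) := rfl

open Classical in
/-- `χ_a^b (h ⊗ e_p) = γ_{ba}(h) ⊗ e_{[(b,a) * p]}` (bar over `(b, a)`) for `p ∈ S_a`. -/
theorem chi_single {a b c : K} (h : a ≤ b) (p : Path c a) (x : H a) :
    N.chi h (incl H a (lp.single 2 (⟨c, p⟩ : PathsTo a) x))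
      = incl H b (lp.single 2 (⟨c, (Seq.up h).cls.comp p⟩ : PathsTo b) (N.γ h x)) := by
  rw [chi_apply, proj_incl]
  congr 1
  apply lp.ext
  funext q
  have e : (⟨c, (Seq.up h).cls.comp p⟩ : PathsTo b) = (PathsTo.shift h).symm ⟨c, p⟩ := rfl
  rw [fiberMap_apply, e]
  by_cases hq : q = (PathsTo.shift h).symm ⟨c, p⟩
  · subst hq
    have e₂ : PathsTo.shift h ((PathsTo.shift h).symm ⟨c, p⟩) = ⟨c, p⟩ :=
      Equiv.apply_symm_apply _ _
    exact (congrArg (N.γ h) ((congrArg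
      (fun z => (lp.single 2 (⟨c, p⟩ : PathsTo a) x : Fiber H a) z) e₂).trans
        (lp.single_apply_self (E := fun _ : PathsTo a => H a) 2 _ x))).trans
      (lp.single_apply_self (E := fun _ : PathsTo b => H b) 2 _ (N.γ h x)).symm
  · have hq' : PathsTo.shift h q ≠ ⟨c, p⟩ := fun hq' =>
      hq (by rw [← hq', Equiv.symm_apply_apply])
    exact ((congrArg (N.γ h)
      (lp.single_apply_ne (E := fun _ : PathsTo a => H a) 2 _ x hq')).trans (map_zero _)).trans
      (lp.single_apply_ne (E := fun _ : PathsTo b => H b) 2 _ (N.γ h x) hq).symm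

theorem star_chi_mul_chi {a b : K} (h : a ≤ b) :
    star (N.chi h) * N.chi h = summandProj H a := by
  refine ContinuousLinearMap.ext fun f => ext_inner_left ℂ fun g => ?_
  change ⟪g, ContinuousLinearMap.adjoint (N.chi h) (N.chi h f)⟫_ℂ = ⟪g, incl H a (proj H a f)⟫_ℂ
  rw [ContinuousLinearMap.adjoint_inner_right, chi_apply, chi_apply, inner_incl, proj_incl,
    LinearIsometry.inner_map_map, ← inner_conj_symm g, inner_incl, inner_conj_symm]

theorem chi_refl (a : K) : N.chi (le_refl a) = summandProj H a := by
  refine ContinuousLinearMap.ext fun f => ?_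
  change incl H a (N.fiberMap (le_refl a) (proj H a f)) = incl H a (proj H a f)
  congr 1
  apply lp.ext
  funext q
  have e : PathsTo.shift (le_refl a) q = q := congrArg (Sigma.mk q.1) (Path.triv_comp q.2)
  rw [fiberMap_apply, N.γ_refl, e]

theorem chi_trans {a b c : K} (h : a ≤ b) (k : b ≤ c) :
    N.chi (h.trans k) = N.chi k * N.chi h := by
  refine ContinuousLinearMap.ext fun f => ?_
  change N.chi (h.trans k) f = N.chi k (N.chi h f)
  rw [chi_apply, chi_apply, chi_apply, proj_incl]
  congr 1
  apply lp.ext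
  funext q
  have e₀ : (Seq.dn (h.trans k)).cls = (Seq.dn h).cls.comp (Seq.dn k).cls :=
    (Quotient.sound (Seq.Rel.dn_dn h k)).symm
  have e : PathsTo.shift (h.trans k) q = PathsTo.shift h (PathsTo.shift k q) := by
    refine congrArg (Sigma.mk q.1) ?_
    rw [e₀, Path.comp_assoc]
    rfl
  rw [fiberMap_apply, fiberMap_apply, fiberMap_apply, N.γ_comp h k, e]

theorem summandProj_mul_self (a : K) : summandProj H a * summandProj H a = summandProj H a := by
  refine ContinuousLinearMap.ext fun f => ?_
  change incl H a (proj H a (incl H a (proj H a f))) = incl H a (proj H a f)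
  rw [proj_incl]

theorem star_summandProj (a : K) : star (summandProj H a) = summandProj H a := by
  refine ContinuousLinearMap.ext fun f => ext_inner_left ℂ fun g => ?_
  change ⟪g, ContinuousLinearMap.adjoint (summandProj H a) f⟫_ℂ = ⟪g, incl H a (proj H a f)⟫_ℂ
  rw [ContinuousLinearMap.adjoint_inner_right]
  change ⟪incl H a (proj H a g), f⟫_ℂ = _
  rw [inner_incl, ← inner_conj_symm g, inner_incl, inner_conj_symm]

theorem chi_mul_summandProj {a b : K} (h : a ≤ b) : N.chi h * summandProj H a = N.chi h := by
  rw [← chi_refl N, ← chi_trans]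

theorem summandProj_mul_chi {a b : K} (h : a ≤ b) : summandProj H b * N.chi h = N.chi h := by
  rw [← chi_refl N, ← chi_trans]

theorem chiSeq_mul_summandProj {a b : K} (p : Seq a b) :
    N.chiSeq p * summandProj H a = N.chiSeq p := by
  have key : ∀ {x y : K} (s : Elem x y), N.chiElem s * summandProj H x = N.chiElem s := by
    intro x y s
    cases s with
    | down h =>
      have := congrArg star (N.summandProj_mul_chi h)
      rwa [star_mul, star_summandProj] at this
    | up h => exact N.chi_mul_summandProj h
  induction p with
  | single s => exact key s
  | cons s p ih => rw [chiSeq, mul_assoc, ih]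

theorem summandProj_mul_chiSeq {a b : K} (p : Seq a b) :
    summandProj H b * N.chiSeq p = N.chiSeq p := by
  have := congrArg star (N.chiSeq_mul_summandProj p.inv)
  rwa [star_mul, star_summandProj, ← star_chiSeq, star_star] at this

theorem gradedPart_corner {a : K} {p : LoopGroup a} {T : Op H} (hT : T ∈ N.gradedPart a p) :
    summandProj H a * T = T ∧ T * summandProj H a = T := by
  have h₁ := mul_eq_of_mem_strongClosure (summandProj H a) 1 (fun S hS => ?_) hT
  have h₂ := mul_eq_of_mem_strongClosure 1 (summandProj H a) (fun S hS => ?_) hT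
  · rw [mul_one] at h₁
    rw [one_mul] at h₂
    exact ⟨h₁, h₂⟩
  · rw [one_mul]
    induction hS using Submodule.span_induction with
    | mem x hx => obtain ⟨q, hq, rfl⟩ := hx; exact N.chiSeq_mul_summandProj q
    | zero => exact zero_mul _
    | add x y _ _ hx hy => rw [add_mul, hx, hy]
    | smul c x _ hx => rw [smul_mul_assoc, hx]
  · rw [mul_one]
    induction hS using Submodule.span_induction with
    | mem x hx => obtain ⟨q, hq, rfl⟩ := hx; exact N.summandProj_mul_chiSeq q
    | zero => exact mul_zero _
    | add x y _ _ hx hy => rw [mul_add, hx, hy]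
    | smul c x _ hx => rw [mul_smul_comm, hx]

theorem gradedPart_subset_localAlgebra (a : K) (p : LoopGroup a) :
    N.gradedPart a p ⊆ N.localAlgebra a := fun _ hT =>
  NonUnitalStarSubalgebra.le_topologicalClosure _
    (NonUnitalStarAlgebra.subset_adjoin ℂ _ (Set.mem_iUnion.2 ⟨p, hT⟩))

theorem chiSeq_mem_gradedPart {a : K} (p : Seq a a) : N.chiSeq p ∈ N.gradedPart a p.loopCls :=
  subset_strongClosure _ (Submodule.subset_span ⟨p, rfl, rfl⟩)

theorem chiSeq_mem_localAlgebra {a : K} (p : Seq a a) : N.chiSeq p ∈ N.localAlgebra a :=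
  N.gradedPart_subset_localAlgebra a _ (N.chiSeq_mem_gradedPart p)

theorem localAlgebra_corner {a : K} {T : Op H} (hT : T ∈ N.localAlgebra a) :
    summandProj H a * T = T ∧ T * summandProj H a = T := by
  have hc : IsClosed {T : Op H | summandProj H a * T = T ∧ T * summandProj H a = T} :=
    (isClosed_eq (continuous_const.mul continuous_id) continuous_id).inter
      (isClosed_eq (continuous_id.mul continuous_const) continuous_id)
  refine closure_minimal ?_ hc hT
  intro S hS
  induction hS using NonUnitalStarAlgebra.adjoin_induction with
  | mem x hx =>
    obtain ⟨p, hp⟩ := Set.mem_iUnion.1 hx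
    exact N.gradedPart_corner hp
  | add x y _ _ hx hy =>
    exact ⟨by rw [mul_add, hx.1, hy.1], by rw [add_mul, hx.2, hy.2]⟩
  | zero => exact ⟨mul_zero _, zero_mul _⟩
  | mul x y _ _ hx hy => exact ⟨by rw [← mul_assoc, hx.1], by rw [mul_assoc, hy.2]⟩
  | smul r x _ hx => exact ⟨by rw [mul_smul_comm, hx.1], by rw [smul_mul_assoc, hx.2]⟩
  | star x _ hx =>
    constructor
    · have := congrArg star hx.2
      rwa [star_mul, star_summandProj] at this
    · have := congrArg star hx.1
      rwa [star_mul, star_summandProj] at this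

theorem conj_mem_gradedPart {a b : K} (h : a ≤ b) {p : LoopGroup a} {T : Op H}
    (hT : T ∈ N.gradedPart a p) :
    N.chi h * T * star (N.chi h) ∈
      N.gradedPart b (((Seq.up h).cls.comp (Path.comp p (Seq.dn h).cls) : Path b b)) := by
  refine mul_mem_strongClosure _ _ (fun S hS => subset_strongClosure _ ?_) hT
  induction hS using Submodule.span_induction with
  | mem x hx =>
    obtain ⟨q, hq, rfl⟩ := hx
    refine Submodule.subset_span ⟨(Seq.up h).comp (q.comp (Seq.dn h)), ?_, ?_⟩
    · rw [← hq]; rfl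
    · rw [chiSeq_comp, chiSeq_comp, ← mul_assoc]; rfl
  | zero => rw [mul_zero, zero_mul]; exact zero_mem _
  | add x y _ _ hx hy => rw [mul_add, add_mul]; exact add_mem hx hy
  | smul c x _ hx => rw [mul_smul_comm, smul_mul_assoc]; exact Submodule.smul_mem _ _ hx

theorem conj_mul {a b : K} (h : a ≤ b) {S T : Op H} (hT : summandProj H a * T = T) :
    N.chi h * (S * T) * star (N.chi h)
      = (N.chi h * S * star (N.chi h)) * (N.chi h * T * star (N.chi h)) := by
  conv_lhs => rw [← hT, ← N.star_chi_mul_chi h]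
  simp only [mul_assoc]

theorem conj_mem_localAlgebra {a b : K} (h : a ≤ b) {T : Op H} (hT : T ∈ N.localAlgebra a) :
    N.chi h * T * star (N.chi h) ∈ N.localAlgebra b := by
  have hb : IsClosed (N.localAlgebra b : Set (Op H)) := inferInstance
  have hc : IsClosed {T : Op H | N.chi h * T * star (N.chi h) ∈ N.localAlgebra b} :=
    hb.preimage (f := fun T : Op H => N.chi h * T * star (N.chi h))
      ((continuous_const.mul continuous_id).mul continuous_const)
  refine closure_minimal ?_ hc hT
  intro S hS
  induction hS using NonUnitalStarAlgebra.adjoin_induction with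
  | mem x hx =>
    obtain ⟨p, hp⟩ := Set.mem_iUnion.1 hx
    exact N.gradedPart_subset_localAlgebra _ _ (N.conj_mem_gradedPart h hp)
  | add x y _ _ hx hy =>
    change N.chi h * (x + y) * star (N.chi h) ∈ N.localAlgebra b
    rw [mul_add, add_mul]
    exact add_mem hx hy
  | zero =>
    change N.chi h * 0 * star (N.chi h) ∈ N.localAlgebra b
    rw [mul_zero, zero_mul]
    exact zero_mem _
  | mul x y _ hy' hx hy =>
    change N.chi h * (x * y) * star (N.chi h) ∈ N.localAlgebra b
    rw [N.conj_mul h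
      (N.localAlgebra_corner (NonUnitalStarSubalgebra.le_topologicalClosure _ hy')).1]
    exact mul_mem hx hy
  | smul r x _ hx =>
    change N.chi h * (r • x) * star (N.chi h) ∈ N.localAlgebra b
    rw [mul_smul_comm, smul_mul_assoc]
    exact SMulMemClass.smul_mem r hx
  | star x _ hx =>
    change N.chi h * star x * star (N.chi h) ∈ N.localAlgebra b
    have hx' : N.chi h * x * star (N.chi h) ∈ N.localAlgebra b := hx
    have := star_mem hx'
    rwa [star_mul, star_mul, star_star, ← mul_assoc] at this

/-- The embedding `α_{ba} : 𝔄_a → 𝔄_b`, `A ↦ χ_a^b A (χ_a^b)*`, for `a ≤ b`. -/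
noncomputable def α {a b : K} (h : a ≤ b) : N.localAlgebra a →⋆ₙₐ[ℂ] N.localAlgebra b where
  toFun T := ⟨N.chi h * T * star (N.chi h), N.conj_mem_localAlgebra h T.2⟩
  map_smul' c T := Subtype.ext (by
    change N.chi h * (c • (T : Op H)) * star (N.chi h) = c • (N.chi h * T * star (N.chi h))
    rw [mul_smul_comm, smul_mul_assoc])
  map_zero' := Subtype.ext (by
    change N.chi h * 0 * star (N.chi h) = 0
    rw [mul_zero, zero_mul])
  map_add' S T := Subtype.ext (by
    change N.chi h * (S + T : Op H) * star (N.chi h) = _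
    rw [mul_add, add_mul]; rfl)
  map_mul' S T := Subtype.ext (N.conj_mul h (N.localAlgebra_corner T.2).1)
  map_star' T := Subtype.ext (by
    change N.chi h * star (T : Op H) * star (N.chi h) = star (N.chi h * T * star (N.chi h))
    rw [star_mul, star_mul, star_star, ← mul_assoc])

end HilbertNet
end Local

/-! ## Nets of `C*`-algebras and morphisms -/

/-- A net of `C*`-algebras `(K, 𝔄_a, α_{ba})_{a ≤ b}` over a partially ordered set `K`. -/
structure CStarNet (K : Type u) [PartialOrder K] (A : K → Type v)
    [∀ a, NonUnitalCStarAlgebra (A a)] where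
  /-- the embedding `α_{ba} : 𝔄_a → 𝔄_b` for `a ≤ b` -/
  α : ∀ {a b : K}, a ≤ b → A a →⋆ₙₐ[ℂ] A b
  α_injective : ∀ {a b : K} (h : a ≤ b), Function.Injective (α h)
  α_refl : ∀ (a : K) (x : A a), α (le_refl a) x = x
  α_comp : ∀ {a b c : K} (h : a ≤ b) (k : b ≤ c) (x : A a), α (h.trans k) x = α k (α h x)

/-- The net of local `C*`-algebras `(K, 𝔄_a, α_{ba})` of a net of Hilbert spaces. -/
noncomputable def HilbertNet.localNet {K : Type u} [PartialOrder K] {H : K → Type v}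
    [∀ a, NormedAddCommGroup (H a)] [∀ a, InnerProductSpace ℂ (H a)] [∀ a, CompleteSpace (H a)]
    (N : HilbertNet K H) : CStarNet K (fun a => N.localAlgebra a) where
  α h := N.α h
  α_injective {a b} h S T hST := by
    have e : N.chi h * (S : Op H) * star (N.chi h) = N.chi h * (T : Op H) * star (N.chi h) :=
      congrArg Subtype.val hST
    have key : ∀ R : N.localAlgebra a,
        star (N.chi h) * (N.chi h * (R : Op H) * star (N.chi h)) * N.chi h = R := fun R => by
      calc _ = (star (N.chi h) * N.chi h) * (R : Op H) * (star (N.chi h) * N.chi h) := by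
            simp only [mul_assoc]
        _ = _ := by
            rw [N.star_chi_mul_chi, (N.localAlgebra_corner R.2).1, (N.localAlgebra_corner R.2).2]
    refine Subtype.ext ?_
    rw [← key S, ← key T, e]
  α_refl a T := Subtype.ext (by
    change N.chi (le_refl a) * (T : Op H) * star (N.chi (le_refl a)) = T
    rw [N.chi_refl, HilbertNet.star_summandProj, (N.localAlgebra_corner T.2).1,
      (N.localAlgebra_corner T.2).2])
  α_comp h k T := Subtype.ext (by
    change N.chi (h.trans k) * (T : Op H) * star (N.chi (h.trans k))
      = N.chi k * (N.chi h * (T : Op H) * star (N.chi h)) * star (N.chi k)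
    rw [N.chi_trans h k, star_mul]
    simp only [mul_assoc])

open Classical in
/-- A morphism `(φ, Φ)` of nets of Hilbert spaces: a morphism `φ` of partially ordered sets and an
isometric embedding `Φ : ⊕ H_a → ⊕ H'_x` which restricts to isometric embeddings
`Φ_a : H_a → H'_{φ(a)}` with `Φ_b ∘ γ_{ba} = γ_{φ(b)φ(a)} ∘ Φ_a`. -/
structure HilbertNet.Hom {K : Type u} [PartialOrder K] {H : K → Type v}
    [∀ a, NormedAddCommGroup (H a)] [∀ a, InnerProductSpace ℂ (H a)]
    {L : Type u'} [PartialOrder L] {H' : L → Type v'}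
    [∀ x, NormedAddCommGroup (H' x)] [∀ x, InnerProductSpace ℂ (H' x)]
    (N : HilbertNet K H) (M : HilbertNet L H') where
  /-- the morphism of partially ordered sets -/
  φ : K →o L
  /-- the isometric embedding of Hilbert space direct sums -/
  Φ : lp H 2 →ₗᵢ[ℂ] lp H' 2
  /-- the restrictions of `Φ` to the summands -/
  Φ_ : ∀ a : K, H a →ₗᵢ[ℂ] H' (φ a)
  Φ_single : ∀ (a : K) (h : H a), Φ (lp.single 2 a h) = lp.single 2 (φ a) (Φ_ a h)
  comm : ∀ {a b : K} (h : a ≤ b) (x : H a), Φ_ b (N.γ h x) = M.γ (φ.monotone h) (Φ_ a x)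

/-- A morphism of nets of `C*`-algebras over a morphism `φ` of partially ordered sets. -/
structure CStarNet.Hom {K : Type u} [PartialOrder K] {A : K → Type v}
    [∀ a, NonUnitalCStarAlgebra (A a)] {L : Type u'} [PartialOrder L] {B : L → Type v'}
    [∀ x, NonUnitalCStarAlgebra (B x)] (φ : K →o L) (𝒜 : CStarNet K A) (ℬ : CStarNet L B) where
  /-- the `*`-homomorphisms `Φ_a : 𝔄_a → 𝔅_{φ(a)}` -/
  Φ : ∀ a : K, A a →⋆ₙₐ[ℂ] B (φ a)
  comm : ∀ {a b : K} (h : a ≤ b) (x : A a), Φ b (𝒜.α h x) = ℬ.α (φ.monotone h) (Φ a x)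

/-- A morphism of nets of `C*`-algebras is faithful if every `Φ_a` is an embedding. -/
def CStarNet.Hom.IsFaithful {K : Type u} [PartialOrder K] {A : K → Type v}
    [∀ a, NonUnitalCStarAlgebra (A a)] {L : Type u'} [PartialOrder L] {B : L → Type v'}
    [∀ x, NonUnitalCStarAlgebra (B x)] {φ : K →o L} {𝒜 : CStarNet K A} {ℬ : CStarNet L B}
    (Ψ : CStarNet.Hom φ 𝒜 ℬ) : Prop :=
  ∀ a, Function.Injective (Ψ.Φ a)

end PosetNet

/-! Left multiplication by `G_a` on `S_a` is free, so every orbit `G_a * r` is a copy of `G_a`. For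
a loop `q`, the operator `χ_q` sends `h ⊗ e_s` to `C_q h ⊗ e_{[q] * s}`, with a coefficient `C_q`
built from the maps `γ` and their adjoints that does not depend on `s`. Hence `χ_q` acts in the same
way on all orbits: on the summand at `a` it is `1 ⊗ T₀`, where `T₀` is its compression to `H_a ⊗
l²(G_a)`. This property (`IsEquivariant`) survives algebraic operations, adjoints, strong limits and
norm limits, so all of `𝔄_a` has it. On `𝔄_a` the compression is therefore a faithful
`*`-homomorphism.

In `L`, injectivity of `φ*` makes `φ*(G_a)` act freely on `S_{φ(a)}`, and the isomorphism `Φ_a`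
identifies the part of the summand at `φ(a)` over each orbit with `H_a ⊗ l²(G_a)`. Define `Φ*_a(T) =
1 ⊗ T₀` with respect to this decomposition (`spread` applied to `compress`). Since `Φ_a` is onto, it
intertwines the adjoints of the `γ` as well as the `γ` themselves, hence all coefficients
(`coef_comm`), and so `Φ*_a(χ_q) = χ_{φ(q)}`. Compatibility with `α_{ba}` is checked orbit by orbit
(`spread_conj`).

The delicate point is that `Φ*_a` maps `𝔄_{a,p}` into `𝔄_{φ(a),φ*(p)}`. An element of `𝔄_{a,p}` is a
strong limit of combinations of cycles with no control of norms, whereas `T₀ ↦ 1 ⊗ T₀` is strongly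
continuous only on bounded sets when there are infinitely many orbits. Von Neumann's density
argument replaces continuity. The relations `S Q = Q' S` valid for all `S` in the span of the class
`p` pass to strong limits and, entry by entry, to amplifications. Applied to projections onto cyclic
subspaces they give approximation at one vector, and a further amplification gives it at finitely
many (`Intertwines.amplify_mem_strongClosure`). Two projections are needed because the span of the
class `p` is not an algebra: it is a right module over the span of the trivial class, and products
`S* R` of its elements lie in that span. -/

namespace PosetNet

set_option linter.unusedSectionVars false

/-! ### Membership in strong closures by filters and by finite sets of vectors. -/

section StrongClosure

variable {E : Type*} [NormedAddCommGroup E] [InnerProductSpace ℂ E]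

/-- The filter is the trace on the set of the neighbourhood filter of `T` for pointwise convergence,
pulled back to bounded operators. It plays the role of an approximating net. -/
theorem exists_filter_of_mem_strongClosure {s : Set (E →L[ℂ] E)} {T : E →L[ℂ] E}
    (hT : T ∈ strongClosure s) :
    ∃ l : Filter (E →L[ℂ] E), l.NeBot ∧ (∀ᶠ S in l, S ∈ s) ∧
      ∀ v, Filter.Tendsto (fun S : E →L[ℂ] E => S v) l (𝓝 (T v)) := by
  let τ := ContinuousLinearMap.toPointwiseConvergenceCLM ℂ (RingHom.id ℂ) E E
  have hτ : Function.Injective τ := fun _ _ h => h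
  have hT' : (𝓝[τ '' s] τ T).NeBot := mem_closure_iff_nhdsWithin_neBot.1 hT
  refine ⟨Filter.comap τ (𝓝[τ '' s] τ T), ?_, ?_, fun v => ?_⟩
  · exact hT'.comap_of_range_mem
      (Filter.mem_of_superset self_mem_nhdsWithin (Set.image_subset_range _ _))
  · refine Filter.mem_comap.2 ⟨τ '' s, self_mem_nhdsWithin, ?_⟩
    rw [hτ.preimage_image]
    exact fun _ h => h
  · have h₁ : Filter.Tendsto τ (Filter.comap τ (𝓝[τ '' s] τ T)) (𝓝 (τ T)) :=
      Filter.tendsto_comap.mono_right nhdsWithin_le_nhds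
    exact PointwiseConvergenceCLM.tendsto_iff_forall_tendsto.1 h₁ v

theorem mem_strongClosure_of_forall_finite {s : Set (E →L[ℂ] E)} {T : E →L[ℂ] E}
    (h : ∀ (t : Finset E) (ε : ℝ), 0 < ε → ∃ S ∈ s, ∀ v ∈ t, ‖S v - T v‖ < ε) :
    T ∈ strongClosure s := by
  change ContinuousLinearMap.toPointwiseConvergenceCLM ℂ (RingHom.id ℂ) E E T ∈ closure _
  rw [(PointwiseConvergenceCLM.isEmbedding_coeFn (RingHom.id ℂ) E
    E).closure_eq_preimage_closure_image, Set.mem_preimage, mem_closure_iff_nhds]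
  intro W hW
  rw [nhds_pi, Filter.mem_pi] at hW
  obtain ⟨I, hI, t, ht, hW⟩ := hW
  -- A basic neighbourhood constrains finitely many vectors only, so one radius serves all of them.
  have : ∀ᶠ ε in 𝓝[>] (0 : ℝ), ∀ i ∈ I, Metric.ball (T i) ε ⊆ t i := by
    rw [Filter.eventually_all_finite hI]
    intro i _
    obtain ⟨δ, hδ, hb⟩ := Metric.mem_nhds_iff.1 (ht i)
    filter_upwards [Ioc_mem_nhdsGT hδ] with ε hε
    exact (Metric.ball_subset_ball hε.2).trans hb
  obtain ⟨ε, hε, hε0⟩ := (this.and self_mem_nhdsWithin).exists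
  obtain ⟨S, hS, hST⟩ := h hI.toFinset ε hε0
  refine ⟨_, hW fun i hi => hε i hi ?_, ⟨_, ⟨S, hS, rfl⟩, rfl⟩⟩
  rw [mem_ball_iff_norm]
  exact hST i (hI.mem_toFinset.2 hi)

/-- A linear identity in `T` that holds on `s` holds on the strong closure of `s`. -/
theorem eq_of_mem_strongClosure {F : Type*} [NormedAddCommGroup F] [NormedSpace ℂ F]
    {s : Set (E →L[ℂ] E)} {ι κ : Type*} {A : ι → E →L[ℂ] F} {v : ι → κ → E}
    {B : ι → E →L[ℂ] F} {w : ι → κ → E}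
    (h : ∀ S ∈ s, ∀ i k, A i (S (v i k)) = B i (S (w i k))) {T : E →L[ℂ] E}
    (hT : T ∈ strongClosure s) (i : ι) (k : κ) : A i (T (v i k)) = B i (T (w i k)) := by
  obtain ⟨l, hl, hs, ht⟩ := exists_filter_of_mem_strongClosure hT
  have h₁ := ((A i).continuous.tendsto _).comp (ht (v i k))
  have h₂ := ((B i).continuous.tendsto _).comp (ht (w i k))
  exact tendsto_nhds_unique_of_eventuallyEq h₁ h₂ (hs.mono fun S hS => h S hS i k)

end StrongClosure

/-! ### Amplifications `1 ⊗ T` on `l²(Y; E)`. -/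

section Amplification

variable {E : Type*} [NormedAddCommGroup E] [InnerProductSpace ℂ E]

/-- Two bounded operators on a Hilbert sum agree if they agree on the vectors `e_i ⊗ x`. -/
theorem lp_ext {ι : Type*} [DecidableEq ι] {G : ι → Type*} [∀ i, NormedAddCommGroup (G i)]
    [∀ i, InnerProductSpace ℂ (G i)] {F : Type*} [NormedAddCommGroup F] [NormedSpace ℂ F]
    {A B : lp G 2 →L[ℂ] F} (h : ∀ i x, A (lp.single 2 i x) = B (lp.single 2 i x)) : A = B :=
  lp.ext_continuousLinearMap (by norm_num) fun i => ContinuousLinearMap.ext fun x => h i x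

variable [CompleteSpace E]

/-- The amplification `T ↦ 1 ⊗ T` from `E` to `l²(Y) ⊗ E = l²(Y; E)`. -/
noncomputable def amplify (E : Type*) [NormedAddCommGroup E] [InnerProductSpace ℂ E] [CompleteSpace E]
    (Y : Type*) :
    (E →L[ℂ] E) →⋆ₐ[ℂ] (lp (fun _ : Y => E) 2 →L[ℂ] lp (fun _ : Y => E) 2) where
  toFun T := lp.mapCLM 2 (fun _ => T) (norm_nonneg T) fun _ => le_rfl
  map_one' := by ext; rfl
  map_mul' S T := by ext; rfl
  map_zero' := by ext; rfl
  map_add' S T := by ext; rfl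
  commutes' c := by ext; rfl
  map_star' T := by
    refine ContinuousLinearMap.ext fun f => ext_inner_left ℂ fun g => ?_
    rw [ContinuousLinearMap.star_eq_adjoint, ContinuousLinearMap.star_eq_adjoint,
      ContinuousLinearMap.adjoint_inner_right, lp.inner_eq_tsum, lp.inner_eq_tsum]
    exact tsum_congr fun y => ContinuousLinearMap.adjoint_inner_right T (g y) (f y)

theorem amplify_apply {Y : Type*} (T : E →L[ℂ] E) (f : lp (fun _ : Y => E) 2) (y : Y) :
    amplify E Y T f y = T (f y) := rfl

theorem norm_amplify_le {Y : Type*} (T : E →L[ℂ] E) : ‖amplify E Y T‖ ≤ ‖T‖ :=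
  lp.norm_mapCLM_le 2 (fun _ : Y => T) (norm_nonneg T) fun _ => le_rfl

theorem amplify_single {Y : Type*} [DecidableEq Y] (T : E →L[ℂ] E) (y : Y) (x : E) :
    amplify E Y T (lp.single 2 y x) = lp.single 2 y (T x) := by
  apply lp.ext
  funext z
  rw [amplify_apply]
  by_cases hz : z = y
  · subst hz
    rw [lp.single_apply_self, lp.single_apply_self]
  · rw [lp.single_apply_ne _ _ _ hz, lp.single_apply_ne _ _ _ hz, map_zero]

/-- On bounded sets the amplification is strongly continuous. -/
theorem tendsto_amplify {Y ι : Type*} {l : Filter ι} {T : ι → E →L[ℂ] E} {A : E →L[ℂ] E} {r : ℝ}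
    (hr : ∀ᶠ i in l, ‖T i‖ ≤ r) (hT : ∀ x, Filter.Tendsto (fun i => T i x) l (𝓝 (A x)))
    (f : lp (fun _ : Y => E) 2) :
    Filter.Tendsto (fun i => amplify E Y (T i) f) l (𝓝 (amplify E Y A f)) := by
  classical
  rw [Metric.tendsto_nhds]
  intro ε hε
  -- `C` bounds the norm of the difference of the amplifications eventually along `l`; the summand 1
  -- makes it positive. Below, `f` is truncated to a finitely supported `g` with error less than `ε
  -- / (2C)`, and on `g` the convergence holds coordinate by coordinate.
  set C := |r| + ‖A‖ + 1 with hC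
  have hC0 : 0 < C := by positivity
  obtain ⟨s, hs⟩ := ((lp.hasSum_single (E := fun _ : Y => E) (p := 2) (by norm_num) f).eventually
    (Metric.ball_mem_nhds f (div_pos hε (mul_pos two_pos hC0)))).exists
  set g : lp (fun _ : Y => E) 2 := ∑ y ∈ s, lp.single 2 y (f y) with hg
  have hgt : Filter.Tendsto (fun i => amplify E Y (T i) g) l (𝓝 (amplify E Y A g)) := by
    simp only [hg, map_sum, amplify_single]
    refine tendsto_finsetSum _ fun y _ => ?_
    exact ((lp.isometry_single (E := fun _ : Y => E) (p := 2) y).continuous.tendsto _).comp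
      (hT (f y))
  filter_upwards [hr, Metric.tendsto_nhds.1 hgt (ε / 2) (half_pos hε)] with i hi hig
  have hs' : ‖f - g‖ < ε / (2 * C) := by rwa [← dist_eq_norm, dist_comm]
  rw [dist_eq_norm] at hig ⊢
  have e : amplify E Y (T i) f - amplify E Y A f
      = (amplify E Y (T i) - amplify E Y A) (f - g) + (amplify E Y (T i) g - amplify E Y A g) := by
    simp only [sub_apply, map_sub]; abel
  have hn : ‖amplify E Y (T i) - amplify E Y A‖ ≤ C := by
    refine (norm_sub_le _ _).trans ?_
    linarith [norm_amplify_le (Y := Y) (T i), norm_amplify_le (Y := Y) A, le_abs_self r]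
  rw [e]
  calc _ ≤ ‖(amplify E Y (T i) - amplify E Y A) (f - g)‖ + ‖amplify E Y (T i) g - amplify E Y A g‖ :=
        norm_add_le _ _
    _ < C * (ε / (2 * C)) + ε / 2 := by
        refine add_lt_add_of_le_of_lt ?_ hig
        exact ((amplify E Y (T i) - amplify E Y A).le_of_opNorm_le hn _).trans
          (mul_le_mul_of_nonneg_left hs'.le hC0.le)
    _ = ε := by field_simp; norm_num

end Amplification

/-! ### A graded density theorem in the style of von Neumann. -/

section Bicommutant

variable {E : Type*} [NormedAddCommGroup E] [InnerProductSpace ℂ E]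

/-- `T` satisfies every relation `S * Q = Q' * S` that holds for all `S ∈ s`. -/
def Intertwines (s : Set (E →L[ℂ] E)) (T : E →L[ℂ] E) : Prop :=
  ∀ Q Q' : E →L[ℂ] E, (∀ S ∈ s, S * Q = Q' * S) → T * Q = Q' * T

variable [CompleteSpace E]

/-- Amplifications are diagonal with constant entry, so the relation `(1 ⊗ S) Q = Q' (1 ⊗ S)` says
exactly `S Q_{yz} = Q'_{yz} S` for all matrix entries. Here `Q_{yz}` is `ev ∘L Q ∘L sg`. -/
theorem Intertwines.amplify {s : Set (E →L[ℂ] E)} {T : E →L[ℂ] E} (hT : Intertwines s T)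
    (Y : Type*) : Intertwines (amplify E Y '' s) (amplify E Y T) := by
  classical
  intro Q Q' h
  refine lp_ext fun z x => lp.ext (funext fun y => ?_)
  let ev : lp (fun _ : Y => E) 2 →L[ℂ] E := lp.evalCLM ℂ (fun _ : Y => E) 2 y
  let sg : E →L[ℂ] lp (fun _ : Y => E) 2 :=
    lp.singleContinuousLinearMap ℂ (fun _ : Y => E) 2 z
  have key : T * (ev ∘L Q ∘L sg) = (ev ∘L Q' ∘L sg) * T := by
    refine hT _ _ fun S hS => ContinuousLinearMap.ext fun x => ?_
    have e := congrArg (fun R => ev (R (lp.single 2 z x))) (h _ ⟨S, hS, rfl⟩)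
    have e' : ev (Q' (PosetNet.amplify E Y S (lp.single 2 z x))) = ev (Q' (sg (S x))) := by
      rw [amplify_single]; rfl
    exact Eq.trans e e'
  have e' : ev (Q' (PosetNet.amplify E Y T (lp.single 2 z x))) = ev (Q' (sg (T x))) := by
    rw [amplify_single]; rfl
  exact Eq.trans (congrArg (fun R : E →L[ℂ] E => R x) key) e'.symm

variable {s₀ s₁ : Submodule ℂ (E →L[ℂ] E)}

/-- A graded version of the von Neumann density theorem. -/
theorem Intertwines.apply_mem_closure (h₁ : (1 : E →L[ℂ] E) ∈ s₀)
    (h₂ : ∀ S ∈ s₁, ∀ R ∈ s₀, S * R ∈ s₁) (h₃ : ∀ S ∈ s₁, ∀ R ∈ s₁, star S * R ∈ s₀)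
    {T : E →L[ℂ] E} (hT : Intertwines (s₁ : Set (E →L[ℂ] E)) T) (f : E) :
    T f ∈ closure ((fun S : E →L[ℂ] E => S f) '' s₁) := by
  let ev : (E →L[ℂ] E) →L[ℂ] E := ContinuousLinearMap.apply ℂ E f
  let W (s : Submodule ℂ (E →L[ℂ] E)) : Submodule ℂ E :=
    (s.map (ev : (E →L[ℂ] E) →ₗ[ℂ] E)).topologicalClosure
  have hW (s : Submodule ℂ (E →L[ℂ] E)) : IsClosed (W s : Set E) :=
    Submodule.isClosed_topologicalClosure _
  have hWc (s : Submodule ℂ (E →L[ℂ] E)) : CompleteSpace (W s) := (hW s).completeSpace_coe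
  have maps {s t : Submodule ℂ (E →L[ℂ] E)} {A : E →L[ℂ] E} (hA : ∀ R ∈ s, A * R ∈ t) {x : E}
      (hx : x ∈ W s) : A x ∈ W t := by
    refine map_mem_closure A.continuous hx ?_
    rintro _ ⟨R, hR, rfl⟩
    exact ⟨A * R, hA R hR, rfl⟩
  -- By `h₂`, `S` maps `W s₀` into `W s₁`. By `h₃`, `S*` maps `W s₁` into `W s₀`, so `S` also maps
  -- the orthogonal complement of `W s₀` into that of `W s₁`. Together these say that `S`
  -- intertwines the two projections.
  have key : ∀ S ∈ (s₁ : Set (E →L[ℂ] E)),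
      S * (W s₀).starProjection = (W s₁).starProjection * S := by
    intro S hS
    refine ContinuousLinearMap.ext fun x => Eq.symm ?_
    refine Submodule.eq_starProjection_of_mem_orthogonal
      (maps (h₂ S hS) (Submodule.starProjection_apply_mem _ x)) ?_
    rw [Submodule.mem_orthogonal]
    intro w hw
    change ⟪w, S x - S ((W s₀).starProjection x)⟫_ℂ = 0
    rw [← map_sub, ← ContinuousLinearMap.adjoint_inner_left]
    exact (Submodule.mem_orthogonal _ _).1 (Submodule.sub_starProjection_mem_orthogonal x) _
      (maps (h₃ S hS) hw)
  -- As `1 ∈ s₀`, the vector `f` lies in `W s₀`. With `P₀`, `P₁` the two projections, `T f = T P₀ f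
  -- = P₁ T f`, which lies in `W s₁`.
  have hf : (W s₀).starProjection f = f :=
    Submodule.starProjection_eq_self_iff.2 (Submodule.le_topologicalClosure _ ⟨1, h₁, rfl⟩)
  have h := congrArg (fun R : E →L[ℂ] E => R f) (hT _ _ key)
  have h' : T f = (W s₁).starProjection (T f) := by
    conv_lhs => rw [← hf]
    exact h
  rw [h']
  exact Submodule.starProjection_apply_mem (W s₁) _

/-- The von Neumann density theorem for amplifications: the amplification of an operator in the
closure of a graded part is in the strong closure of the amplification. -/
theorem Intertwines.amplify_mem_strongClosure (h₁ : (1 : E →L[ℂ] E) ∈ s₀)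
    (h₂ : ∀ S ∈ s₁, ∀ R ∈ s₀, S * R ∈ s₁) (h₃ : ∀ S ∈ s₁, ∀ R ∈ s₁, star S * R ∈ s₀)
    {T : E →L[ℂ] E} (hT : Intertwines (s₁ : Set (E →L[ℂ] E)) T) (Y : Type*) :
    PosetNet.amplify E Y T ∈ strongClosure (PosetNet.amplify E Y '' s₁) := by
  classical
  refine mem_strongClosure_of_forall_finite fun t ε hε => ?_
  -- The second amplification reduces finitely many vectors to one. Its index set is the space
  -- `l²(Y; E)` itself, so that each `v ∈ t` can be put at the coordinate `v`.
  let D := (PosetNet.amplify (lp (fun _ : Y => E) 2) (lp (fun _ : Y => E) 2)).comp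
    (PosetNet.amplify E Y)
  let D' : (E →L[ℂ] E) →ₗ[ℂ] _ := D.toAlgHom.toLinearMap
  have hD : Intertwines ((s₁.map D' : Submodule ℂ _) : Set _) (D T) := by
    have := (hT.amplify Y).amplify (lp (fun _ : Y => E) 2)
    rw [Set.image_image] at this
    exact this
  have h := hD.apply_mem_closure (s₀ := s₀.map D') ⟨1, h₁, map_one D⟩
    (by
      rintro _ ⟨S, hS, rfl⟩ _ ⟨R, hR, rfl⟩
      exact ⟨S * R, h₂ S hS R hR, map_mul D S R⟩)
    (by
      rintro _ ⟨S, hS, rfl⟩ _ ⟨R, hR, rfl⟩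
      exact ⟨star S * R, h₃ S hS R hR, (map_mul D _ R).trans (congrArg (· * _) (map_star D S))⟩)
    (∑ v ∈ t, lp.single 2 v v)
  obtain ⟨_, ⟨_, ⟨S, hS, rfl⟩, rfl⟩, hd⟩ := Metric.mem_closure_iff.1 h ε hε
  refine ⟨_, ⟨S, hS, rfl⟩, fun v hv => ?_⟩
  rw [dist_comm, dist_eq_norm] at hd
  refine lt_of_le_of_lt ?_ hd
  have hv' : (∑ w ∈ t, lp.single (E := fun _ : lp (fun _ : Y => E) 2 => lp (fun _ : Y => E) 2)
      2 w w) v = v := by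
    rw [lp.coeFn_sum, Finset.sum_apply, Finset.sum_eq_single v]
    · exact lp.single_apply_self _ _ _
    · exact fun w _ hw => lp.single_apply_ne _ _ _ hw.symm
    · exact fun h => absurd hv h
  have h₄ := lp.norm_apply_le_norm two_ne_zero
    (D S (∑ v ∈ t, lp.single 2 v v) - D T (∑ v ∈ t, lp.single 2 v v)) v
  refine le_trans (le_of_eq ?_) h₄
  change _ = ‖PosetNet.amplify E Y S ((∑ v ∈ t, lp.single 2 v v : lp _ 2) v)
    - PosetNet.amplify E Y T ((∑ v ∈ t, lp.single 2 v v : lp _ 2) v)‖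
  rw [hv']

end Bicommutant

/-! ### The action of paths on `S_a` -/

namespace Path

variable {K : Type u} [PartialOrder K] {L : Type v} [PartialOrder L]

theorem inv_comp {a b : K} (p : Path a b) : p.inv.comp p = (Seq.triv a).cls := by
  induction p using Quotient.inductionOn
  exact Quotient.sound (Seq.inv_comp _)

theorem comp_inv {a b : K} (p : Path a b) : p.comp p.inv = (Seq.triv b).cls := by
  induction p using Quotient.inductionOn
  exact Quotient.sound (Seq.comp_inv _)

theorem comp_left_injective {a b c : K} (r : Path a b) :
    Function.Injective fun p : Path b c => p.comp r := by
  intro p q h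
  have h' := congrArg (fun s => Path.comp s r.inv) h
  simpa only [comp_assoc, comp_inv, comp_triv] using h'

theorem comp_right_injective {a b c : K} (r : Path b c) :
    Function.Injective fun p : Path a b => r.comp p := by
  intro p q h
  have h' := congrArg (fun s => Path.comp r.inv s) h
  simpa only [← comp_assoc, inv_comp, triv_comp] using h'

theorem map_comp (φ : K →o L) {a b c : K} (p : Path b c) (q : Path a b) :
    (p.comp q).map φ = (p.map φ).comp (q.map φ) := by
  induction p using Quotient.inductionOn
  induction q using Quotient.inductionOn
  exact congrArg Seq.cls (Seq.map_comp φ _ _)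

/-- Injectivity of `φ*` on loops does not depend on the base point. -/
theorem map_injective_of_path (φ : K →o L) {a₀ a : K} (r : Path a₀ a)
    (h : Function.Injective fun p : Path a₀ a₀ => p.map φ) :
    Function.Injective fun p : Path a a => p.map φ := by
  intro p q hpq
  have e : (r.inv.comp (p.comp r)).map φ = (r.inv.comp (q.comp r)).map φ := by
    simp only [map_comp]
    rw [show p.map φ = q.map φ from hpq]
  exact comp_left_injective r (comp_right_injective r.inv (h e))

end Path

namespace PathsTo

variable {K : Type u} [PartialOrder K]

/-- Left multiplication by a path from `a` to `b`, as a map `S_a → S_b`. -/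
def act {a b : K} (p : Path a b) (s : PathsTo a) : PathsTo b := ⟨s.1, p.comp s.2⟩

theorem act_comp {a b c : K} (p : Path b c) (q : Path a b) (s : PathsTo a) :
    act (p.comp q) s = act p (act q s) := congrArg (Sigma.mk s.1) (Path.comp_assoc p q s.2)

theorem act_triv {a : K} (s : PathsTo a) : act (Seq.triv a).cls s = s :=
  congrArg (Sigma.mk s.1) (Path.triv_comp s.2)

/-- Freeness of the action: for `b = a`, each orbit of `G_a` in `S_a` is a copy of `G_a`. -/
theorem act_left_injective {a b : K} (s : PathsTo a) :
    Function.Injective fun p : Path a b => act p s := by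
  intro p q h
  exact Path.comp_left_injective s.2 (eq_of_heq (Sigma.mk.inj h).2)

end PathsTo

open scoped Classical

/-! ### Operators on the vectors `h ⊗ e_p` -/

section Vectors

variable {K : Type u} [PartialOrder K] {H : K → Type v}
  [∀ a, NormedAddCommGroup (H a)] [∀ a, InnerProductSpace ℂ (H a)] [∀ a, CompleteSpace (H a)]

/-- The isometry `h ↦ h ⊗ e_s`. -/
noncomputable def vec (H : K → Type v) [∀ a, NormedAddCommGroup (H a)]
    [∀ a, InnerProductSpace ℂ (H a)] {a : K} (s : PathsTo a) : H a →ₗᵢ[ℂ] TotalSpace H where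
  toLinearMap := (incl H a ∘L
    lp.singleContinuousLinearMap ℂ (fun _ : PathsTo a => H a) 2 s).toLinearMap
  norm_map' x := by
    have h₁ : ‖lp.single (E := fun a : K => Fiber H a) 2 a
        (lp.single (E := fun _ : PathsTo a => H a) 2 s x)‖ = ‖x‖ := by
      rw [lp.norm_single (by norm_num), lp.norm_single (by norm_num)]
    exact h₁

theorem vec_apply {a : K} (s : PathsTo a) (x : H a) :
    vec H s x = incl H a (lp.single 2 s x) := rfl

theorem inner_vec {a : K} (s : PathsTo a) (x : H a) (f : TotalSpace H) :
    ⟪vec H s x, f⟫_ℂ = ⟪x, proj H a f s⟫_ℂ := by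
  rw [vec_apply, HilbertNet.inner_incl, lp.inner_single_left]

theorem inner_vec_vec_of_ne {a : K} {s t : PathsTo a} (h : s ≠ t) (x y : H a) :
    ⟪vec H s x, vec H t y⟫_ℂ = 0 := by
  rw [inner_vec, vec_apply, HilbertNet.proj_incl, lp.single_apply_ne _ _ _ h, inner_zero_right]

theorem summandProj_vec {a : K} (s : PathsTo a) (x : H a) :
    HilbertNet.summandProj H a (vec H s x) = vec H s x := by
  change incl H a (proj H a (incl H a (lp.single 2 s x))) = incl H a (lp.single 2 s x)
  rw [HilbertNet.proj_incl]

theorem summand_ext {a : K} {F : Type*} [NormedAddCommGroup F] [NormedSpace ℂ F]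
    {A B : TotalSpace H →L[ℂ] F} (hA : A ∘L HilbertNet.summandProj H a = A)
    (hB : B ∘L HilbertNet.summandProj H a = B)
    (h : ∀ (s : PathsTo a) (x : H a), A (vec H s x) = B (vec H s x)) : A = B := by
  have e : A ∘L incl H a = B ∘L incl H a := lp_ext h
  rw [← hA, ← hB]
  exact congrArg (fun R => R ∘L proj H a) e

variable (N : HilbertNet K H)

theorem HilbertNet.chi_vec {a b : K} (h : a ≤ b) (s : PathsTo a) (x : H a) :
    N.chi h (vec H s x) = vec H (s.act (Seq.up h).cls) (N.γ h x) :=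
  N.chi_single h s.2 x

/-- `χ_a^b` is a bijection of path labels combined with `γ_{ba}`. Its adjoint is therefore the
inverse bijection combined with the adjoint of `γ_{ba}`. -/
theorem HilbertNet.star_chi_vec {a b : K} (h : a ≤ b) (s : PathsTo b) (x : H b) :
    star (N.chi h) (vec H s x)
      = vec H (s.act (Seq.dn h).cls)
          (ContinuousLinearMap.adjoint (N.γ h).toContinuousLinearMap x) := by
  refine ext_inner_right ℂ fun g => ?_
  rw [ContinuousLinearMap.star_eq_adjoint, ContinuousLinearMap.adjoint_inner_left, inner_vec,
    inner_vec, ContinuousLinearMap.adjoint_inner_left, N.chi_apply, HilbertNet.proj_incl,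
    N.fiberMap_apply]
  rfl

/-- The coefficient `H_a → H_b` of the operator of an elementary path. -/
noncomputable def HilbertNet.coefElem (N : HilbertNet K H) {a b : K} : Elem a b → H a →L[ℂ] H b
  | .down h => ContinuousLinearMap.adjoint (N.γ h).toContinuousLinearMap
  | .up h => (N.γ h).toContinuousLinearMap

/-- The coefficient `H_a → H_b` of the operator `χ_q`. -/
noncomputable def HilbertNet.coef (N : HilbertNet K H) {a b : K} : Seq a b → H a →L[ℂ] H b
  | .single s => N.coefElem s
  | .cons s q => N.coefElem s ∘L N.coef q

theorem HilbertNet.chiElem_vec {a b : K} (t : Elem a b) (s : PathsTo a) (x : H a) :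
    N.chiElem t (vec H s x) = vec H (s.act (Seq.single t).cls) (N.coefElem t x) := by
  cases t with
  | down k => exact N.star_chi_vec k s x
  | up k => exact N.chi_vec k s x

/-- The path label and the vector in `H_a` are moved independently; this is the source of
equivariance. The label sees only the class of `q`, whereas the coefficient depends on the sequence.
-/
theorem HilbertNet.chiSeq_vec {a b : K} (q : Seq a b) (s : PathsTo a) (x : H a) :
    N.chiSeq q (vec H s x) = vec H (s.act q.cls) (N.coef q x) := by
  induction q with
  | single t => exact N.chiElem_vec t s x
  | cons t q ih =>
    change N.chiElem t (N.chiSeq q (vec H s x)) = _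
    rw [ih, N.chiElem_vec]
    exact congrArg (fun z => vec H z _) (PathsTo.act_comp _ _ _).symm

end Vectors

/-! ### Isometries onto orbits -/

section Orbits

variable {K : Type u} [PartialOrder K] {H : K → Type v}
  [∀ a, NormedAddCommGroup (H a)] [∀ a, InnerProductSpace ℂ (H a)] [∀ a, CompleteSpace (H a)]
  {E : Type*} [NormedAddCommGroup E] [InnerProductSpace ℂ E] {G : Type*}

theorem orthogonalFamily_vec {a : K} {σ : G → PathsTo a} (hσ : Function.Injective σ)
    (Θ : E →ₗᵢ[ℂ] H a) :
    OrthogonalFamily ℂ (fun _ : G => E) fun g => (vec H (σ g)).comp Θ :=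
  fun _ _ hij x y => inner_vec_vec_of_ne (hσ.ne hij) (Θ x) (Θ y)

/-- The isometry `l²(G) ⊗ E → H_a ⊗ l²(S_a)`, `e_g ⊗ x ↦ Θ x ⊗ e_{σ g}`. -/
noncomputable def orbitIsometry {a : K} {σ : G → PathsTo a} (hσ : Function.Injective σ)
    (Θ : E →ₗᵢ[ℂ] H a) : lp (fun _ : G => E) 2 →ₗᵢ[ℂ] TotalSpace H :=
  (orthogonalFamily_vec hσ Θ).linearIsometry

theorem orbitIsometry_single {a : K} {σ : G → PathsTo a} (hσ : Function.Injective σ)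
    (Θ : E →ₗᵢ[ℂ] H a) (g : G) (x : E) :
    orbitIsometry hσ Θ (lp.single 2 g x) = vec H (σ g) (Θ x) :=
  (orthogonalFamily_vec hσ Θ).linearIsometry_apply_single x

theorem summandProj_orbitIsometry {a : K} {σ : G → PathsTo a} (hσ : Function.Injective σ)
    (Θ : E →ₗᵢ[ℂ] H a) (f : lp (fun _ : G => E) 2) :
    HilbertNet.summandProj H a (orbitIsometry hσ Θ f) = orbitIsometry hσ Θ f := by
  have e : HilbertNet.summandProj H a ∘L (orbitIsometry hσ Θ).toContinuousLinearMap
      = (orbitIsometry hσ Θ).toContinuousLinearMap := lp_ext fun g x => by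
    change HilbertNet.summandProj H a (orbitIsometry hσ Θ (lp.single 2 g x))
      = orbitIsometry hσ Θ (lp.single 2 g x)
    rw [orbitIsometry_single, summandProj_vec]
  exact congrArg (fun R : _ →L[ℂ] TotalSpace H => R f) e

theorem inner_orbitIsometry_of_disjoint {a : K} {G' E' : Type*} [NormedAddCommGroup E']
    [InnerProductSpace ℂ E'] {σ : G → PathsTo a}
    (hσ : Function.Injective σ) {σ' : G' → PathsTo a} (hσ' : Function.Injective σ')
    (Θ : E →ₗᵢ[ℂ] H a) (Θ' : E' →ₗᵢ[ℂ] H a) (hd : ∀ g g', σ g ≠ σ' g')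
    (f : lp (fun _ : G => E) 2) (f' : lp (fun _ : G' => E') 2) :
    ⟪orbitIsometry hσ Θ f, orbitIsometry hσ' Θ' f'⟫_ℂ = 0 := by
  have e₁ (s : PathsTo a) (x : H a) (hs : ∀ g, σ g ≠ s) :
      innerSL ℂ (vec H s x) ∘L (orbitIsometry hσ Θ).toContinuousLinearMap = 0 :=
    lp_ext fun g y => by
      change ⟪vec H s x, orbitIsometry hσ Θ (lp.single 2 g y)⟫_ℂ = 0
      rw [orbitIsometry_single]
      exact inner_vec_vec_of_ne (hs g).symm _ _
  have e₂ : innerSL ℂ (orbitIsometry hσ Θ f) ∘L (orbitIsometry hσ' Θ').toContinuousLinearMap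
      = 0 := lp_ext fun g' y => by
    change ⟪orbitIsometry hσ Θ f, orbitIsometry hσ' Θ' (lp.single 2 g' y)⟫_ℂ = 0
    rw [orbitIsometry_single, ← inner_conj_symm]
    have := congrArg (fun R : lp (fun _ : G => E) 2 →L[ℂ] ℂ => R f)
      (e₁ (σ' g') (Θ' y) fun g => hd g g')
    exact (congrArg _ this).trans (map_zero _)
  exact congrArg (fun R : lp (fun _ : G' => E') 2 →L[ℂ] ℂ => R f') e₂

theorem adjoint_apply_self {E F : Type*} [NormedAddCommGroup E] [InnerProductSpace ℂ E]
    [CompleteSpace E] [NormedAddCommGroup F] [InnerProductSpace ℂ F] [CompleteSpace F]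
    (V : E →ₗᵢ[ℂ] F) (x : E) :
    ContinuousLinearMap.adjoint V.toContinuousLinearMap (V x) = x := by
  refine ext_inner_left ℂ fun y => ?_
  rw [ContinuousLinearMap.adjoint_inner_right]
  exact V.inner_map_map y x

/-- Conjugation `T ↦ V T V*` by an isometry `V`. -/
noncomputable def conjIsometry {E F : Type*} [NormedAddCommGroup E] [InnerProductSpace ℂ E]
    [CompleteSpace E] [NormedAddCommGroup F] [InnerProductSpace ℂ F] [CompleteSpace F]
    (V : E →ₗᵢ[ℂ] F) : (E →L[ℂ] E) →⋆ₙₐ[ℂ] (F →L[ℂ] F) where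
  toFun T := V.toContinuousLinearMap ∘L T ∘L
    ContinuousLinearMap.adjoint V.toContinuousLinearMap
  map_smul' c T := ContinuousLinearMap.ext fun v => map_smul V c _
  map_zero' := ContinuousLinearMap.ext fun v => map_zero V
  map_add' S T := ContinuousLinearMap.ext fun v => map_add V _ _
  map_mul' S T := ContinuousLinearMap.ext fun v =>
    congrArg (fun x => V (S x)) (adjoint_apply_self V _).symm
  map_star' T := by
    rw [ContinuousLinearMap.star_eq_adjoint, ContinuousLinearMap.star_eq_adjoint,
      ContinuousLinearMap.adjoint_comp, ContinuousLinearMap.adjoint_comp,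
      ContinuousLinearMap.adjoint_adjoint]
    rfl

theorem norm_conjIsometry_le {E F : Type*} [NormedAddCommGroup E] [InnerProductSpace ℂ E]
    [CompleteSpace E] [NormedAddCommGroup F] [InnerProductSpace ℂ F] [CompleteSpace F]
    (V : E →ₗᵢ[ℂ] F) (T : E →L[ℂ] E) : ‖conjIsometry V T‖ ≤ ‖T‖ := by
  have h₁ : ‖V.toContinuousLinearMap‖ ≤ 1 := LinearIsometry.norm_toContinuousLinearMap_le _
  have h₂ : ‖ContinuousLinearMap.adjoint V.toContinuousLinearMap‖ ≤ 1 := by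
    rw [LinearIsometryEquiv.norm_map]; exact h₁
  refine (ContinuousLinearMap.opNorm_comp_le _ _).trans ?_
  refine (mul_le_of_le_one_left (norm_nonneg _) h₁).trans ?_
  refine (ContinuousLinearMap.opNorm_comp_le _ _).trans ?_
  exact mul_le_of_le_one_right (norm_nonneg _) h₂

end Orbits

/-! ### Compression to the loops at a base point -/

section Compression

variable {K : Type u} [PartialOrder K] {H : K → Type v}
  [∀ a, NormedAddCommGroup (H a)] [∀ a, InnerProductSpace ℂ (H a)] [∀ a, CompleteSpace (H a)]

/-- The Hilbert space `H_a ⊗ l²(G_a)`. -/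
abbrev LoopSpace (H : K → Type v) [∀ a, NormedAddCommGroup (H a)]
    [∀ a, InnerProductSpace ℂ (H a)] (a : K) : Type (max u v) :=
  lp (fun _ : Path a a => H a) 2

/-- The isometry `H_a ⊗ l²(G_a) → H_a ⊗ l²(S_a)`, `h ⊗ e_g ↦ h ⊗ e_{g * r}`. -/
noncomputable def loopEmb (H : K → Type v) [∀ a, NormedAddCommGroup (H a)]
    [∀ a, InnerProductSpace ℂ (H a)] [∀ a, CompleteSpace (H a)] {a : K} (r : PathsTo a) :
    LoopSpace H a →ₗᵢ[ℂ] TotalSpace H :=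
  orbitIsometry (PathsTo.act_left_injective r) LinearIsometry.id

theorem loopEmb_single {a : K} (r : PathsTo a) (g : Path a a) (x : H a) :
    loopEmb H r (lp.single 2 g x) = vec H (r.act g) x :=
  orbitIsometry_single _ _ g x

/-- The trivial path at `a` as an element of `S_a`. -/
def PathsTo.base (a : K) : PathsTo a := ⟨a, (Seq.triv a).cls⟩

/-- The adjoint of `loopEmb`. -/
noncomputable def loopProj (H : K → Type v) [∀ a, NormedAddCommGroup (H a)]
    [∀ a, InnerProductSpace ℂ (H a)] [∀ a, CompleteSpace (H a)] {a : K} (r : PathsTo a) :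
    TotalSpace H →L[ℂ] LoopSpace H a :=
  ContinuousLinearMap.adjoint (loopEmb H r).toContinuousLinearMap

theorem loopProj_loopEmb {a : K} (r : PathsTo a) (f : LoopSpace H a) :
    loopProj H r (loopEmb H r f) = f := adjoint_apply_self _ f

theorem loopProj_vec {a : K} (r : PathsTo a) (g : Path a a) (x : H a) :
    loopProj H r (vec H (r.act g) x) = lp.single 2 g x := by
  rw [← loopEmb_single, loopProj_loopEmb]

/-- The compression of an operator to `H_a ⊗ l²(G_a)`. -/
noncomputable def compress (a : K) : Op H →ₗ[ℂ] (LoopSpace H a →L[ℂ] LoopSpace H a) where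
  toFun T := loopProj H (.base a) ∘L T ∘L (loopEmb H (.base a)).toContinuousLinearMap
  map_add' S T := by rw [ContinuousLinearMap.add_comp, ContinuousLinearMap.comp_add]
  map_smul' c T := by
    rw [ContinuousLinearMap.smul_comp, ContinuousLinearMap.comp_smul]; rfl

theorem compress_apply {a : K} (T : Op H) (f : LoopSpace H a) :
    compress a T f = loopProj H (.base a) (T (loopEmb H (.base a) f)) := rfl

theorem compress_star {a : K} (T : Op H) : compress a (star T) = star (compress a T) := by
  simp only [ContinuousLinearMap.star_eq_adjoint]
  change _ = ContinuousLinearMap.adjoint (_ ∘L T ∘L _)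
  rw [ContinuousLinearMap.adjoint_comp, ContinuousLinearMap.adjoint_comp, loopProj,
    ContinuousLinearMap.adjoint_adjoint]
  rfl

theorem norm_compress_le {a : K} (T : Op H) : ‖compress a T‖ ≤ ‖T‖ := by
  have h₁ : ‖(loopEmb H (.base a)).toContinuousLinearMap‖ ≤ 1 :=
    LinearIsometry.norm_toContinuousLinearMap_le _
  have h₂ : ‖loopProj H (.base a)‖ ≤ 1 := by
    rw [loopProj, LinearIsometryEquiv.norm_map]; exact h₁
  refine (ContinuousLinearMap.opNorm_comp_le _ _).trans ?_
  refine (mul_le_of_le_one_left (norm_nonneg _) h₂).trans ?_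
  refine (ContinuousLinearMap.opNorm_comp_le _ _).trans ?_
  exact mul_le_of_le_one_right (norm_nonneg _) h₁

theorem continuous_compress (a : K) : Continuous (compress a : Op H → _) :=
  AddMonoidHomClass.continuous_of_bound (compress a) 1 fun T => by
    rw [one_mul]; exact norm_compress_le T

/-- `T` acts on all orbits of `G_a` in `S_a` in the same way. -/
structure IsEquivariant (a : K) (T : Op H) : Prop where
  apply_emb : ∀ (r : PathsTo a) (f : LoopSpace H a),
    T (loopEmb H r f) = loopEmb H r (compress a T f)
  proj_apply : ∀ (r : PathsTo a) (v : TotalSpace H),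
    loopProj H r (T v) = compress a T (loopProj H r v)

/-! ### Equivariant operators form a `*`-algebra closed strongly and in norm. -/

namespace IsEquivariant

variable {a : K} {S T : Op H}

theorem zero : IsEquivariant a (0 : Op H) where
  apply_emb r f := by rw [map_zero]; exact (map_zero (loopEmb H r)).symm
  proj_apply r v := by rw [map_zero]; exact map_zero (loopProj H r)

theorem add (hS : IsEquivariant a S) (hT : IsEquivariant a T) : IsEquivariant a (S + T) where
  apply_emb r f := by
    rw [map_add, add_apply, add_apply, map_add, hS.apply_emb, hT.apply_emb]
  proj_apply r v := by
    rw [map_add, add_apply, add_apply, map_add, hS.proj_apply, hT.proj_apply]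

theorem smul (c : ℂ) (hT : IsEquivariant a T) : IsEquivariant a (c • T) where
  apply_emb r f := by
    rw [map_smul, smul_apply, smul_apply, map_smul, hT.apply_emb]
  proj_apply r v := by
    rw [map_smul, smul_apply, smul_apply, map_smul, hT.proj_apply]

/-- `T` maps the base orbit subspace into itself, so nothing is lost by projecting between the two
factors. -/
theorem compress_mul (S : Op H) (hT : IsEquivariant a T) :
    compress a (S * T) = compress a S * compress a T := by
  ext1 f
  change loopProj H _ (S (T (loopEmb H _ f))) = _
  rw [hT.apply_emb]
  rfl

theorem mul (hS : IsEquivariant a S) (hT : IsEquivariant a T) : IsEquivariant a (S * T) where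
  apply_emb r f := by
    rw [compress_mul S hT]
    change S (T (loopEmb H r f)) = loopEmb H r (compress a S (compress a T f))
    rw [hT.apply_emb, hS.apply_emb]
  proj_apply r v := by
    rw [compress_mul S hT]
    change loopProj H r (S (T v)) = compress a S (compress a T (loopProj H r v))
    rw [hS.proj_apply, hT.proj_apply]

/-- Taking adjoints exchanges the two defining conditions; this is why both are required. -/
theorem star (hT : IsEquivariant a T) : IsEquivariant a (star T) where
  apply_emb r f := ext_inner_right ℂ fun v => by
    rw [compress_star, ContinuousLinearMap.star_eq_adjoint, ContinuousLinearMap.star_eq_adjoint,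
      ContinuousLinearMap.adjoint_inner_left]
    change _ = ⟪(loopEmb H r).toContinuousLinearMap _, v⟫_ℂ
    rw [← ContinuousLinearMap.adjoint_inner_right, ContinuousLinearMap.adjoint_inner_left]
    change ⟪(loopEmb H r).toContinuousLinearMap f, T v⟫_ℂ = ⟪f, compress a T (loopProj H r v)⟫_ℂ
    rw [← ContinuousLinearMap.adjoint_inner_right]
    exact congrArg (inner ℂ f) (hT.proj_apply r v)
  proj_apply r v := ext_inner_right ℂ fun f => by
    rw [compress_star, ContinuousLinearMap.star_eq_adjoint, ContinuousLinearMap.star_eq_adjoint,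
      ContinuousLinearMap.adjoint_inner_left, loopProj, ContinuousLinearMap.adjoint_inner_left,
      ContinuousLinearMap.adjoint_inner_left, ContinuousLinearMap.adjoint_inner_left]
    exact congrArg (inner ℂ v) (hT.apply_emb r f)

/-- Once the compression is unfolded, each condition compares the values of `T` at two fixed vectors
through fixed bounded operators, so it survives strong limits. -/
theorem of_mem_strongClosure {s : Set (Op H)} (hs : ∀ S ∈ s, IsEquivariant a S)
    (hT : T ∈ strongClosure s) : IsEquivariant a T where
  apply_emb r f := by
    exact eq_of_mem_strongClosure (ι := Unit) (κ := Unit) (A := fun _ => 1)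
      (v := fun _ _ => loopEmb H r f)
      (B := fun _ => (loopEmb H r).toContinuousLinearMap ∘L loopProj H (.base a))
      (w := fun _ _ => loopEmb H (.base a) f)
      (fun S hS _ _ => (hs S hS).apply_emb r f) hT () ()
  proj_apply r v := by
    exact eq_of_mem_strongClosure (ι := Unit) (κ := Unit) (A := fun _ => loopProj H r)
      (v := fun _ _ => v) (B := fun _ => loopProj H (.base a))
      (w := fun _ _ => loopEmb H (.base a) (loopProj H r v))
      (fun S hS _ _ => (hs S hS).proj_apply r v) hT () ()

theorem isClosed (a : K) : IsClosed {T : Op H | IsEquivariant a T} := by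
  have e : {T : Op H | IsEquivariant a T}
      = {T | ∀ (r : PathsTo a) (f : LoopSpace H a),
          T (loopEmb H r f) = loopEmb H r (compress a T f)} ∩
        {T | ∀ (r : PathsTo a) (v : TotalSpace H),
          loopProj H r (T v) = compress a T (loopProj H r v)} :=
    Set.ext fun T => ⟨fun h => ⟨h.1, h.2⟩, fun h => ⟨h.1, h.2⟩⟩
  rw [e]
  refine IsClosed.inter ?_ ?_
  · simp only [Set.ofPred_forall]
    refine isClosed_iInter fun r => isClosed_iInter fun f => isClosed_eq ?_ ?_
    · exact (ContinuousLinearMap.apply ℂ _ (loopEmb H r f)).continuous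
    · exact (loopEmb H r).continuous.comp
        ((ContinuousLinearMap.apply ℂ _ f).continuous.comp (continuous_compress a))
  · simp only [Set.ofPred_forall]
    refine isClosed_iInter fun r => isClosed_iInter fun v => isClosed_eq ?_ ?_
    · exact (loopProj H r).continuous.comp (ContinuousLinearMap.apply ℂ _ v).continuous
    · exact (ContinuousLinearMap.apply ℂ _ (loopProj H r v)).continuous.comp
        (continuous_compress a)

end IsEquivariant

/-! ### Equivariance of the local algebras and the compressed graded spans. -/

namespace HilbertNet

variable (N : HilbertNet K H) {a : K}

theorem compress_chiSeq_single (q : Seq a a) (g : Path a a) (x : H a) :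
    compress a (N.chiSeq q) (lp.single 2 g x) = lp.single 2 (q.cls.comp g) (N.coef q x) := by
  rw [compress_apply, loopEmb_single, chiSeq_vec, ← PathsTo.act_comp, loopProj_vec]

theorem chiSeq_loopEmb (q : Seq a a) (r : PathsTo a) (f : LoopSpace H a) :
    N.chiSeq q (loopEmb H r f) = loopEmb H r (compress a (N.chiSeq q) f) := by
  have e : N.chiSeq q ∘L (loopEmb H r).toContinuousLinearMap
      = (loopEmb H r).toContinuousLinearMap ∘L compress a (N.chiSeq q) := lp_ext fun g x => by
    change N.chiSeq q (loopEmb H r (lp.single 2 g x))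
      = loopEmb H r (compress a (N.chiSeq q) (lp.single 2 g x))
    rw [compress_chiSeq_single, loopEmb_single, loopEmb_single, chiSeq_vec, PathsTo.act_comp]
  exact congrArg (fun R : LoopSpace H a →L[ℂ] TotalSpace H => R f) e

/-- The second condition is the adjoint of the first one for the reverse loop, since `χ_q* =
χ_{q.inv}`. -/
theorem isEquivariant_chiSeq (q : Seq a a) : IsEquivariant a (N.chiSeq q) where
  apply_emb := N.chiSeq_loopEmb q
  proj_apply r v := ext_inner_right ℂ fun f => by
    have h := congrArg (inner ℂ v) (N.chiSeq_loopEmb q.inv r f)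
    rw [← star_chiSeq, compress_star, ContinuousLinearMap.star_eq_adjoint,
      ContinuousLinearMap.star_eq_adjoint, ContinuousLinearMap.adjoint_inner_right] at h
    rw [loopProj, ContinuousLinearMap.adjoint_inner_left,
      ← ContinuousLinearMap.adjoint_inner_right (compress a (N.chiSeq q)),
      ContinuousLinearMap.adjoint_inner_left]
    exact h

theorem isEquivariant_of_mem_span {p : LoopGroup a} {T : Op H}
    (hT : T ∈ Submodule.span ℂ (N.cycles a p)) : IsEquivariant a T := by
  induction hT using Submodule.span_induction with
  | mem x hx => obtain ⟨q, _, rfl⟩ := hx; exact N.isEquivariant_chiSeq q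
  | zero => exact .zero
  | add x y _ _ hx hy => exact hx.add hy
  | smul c x _ hx => exact hx.smul c

theorem isEquivariant_of_mem_localAlgebra {T : Op H} (hT : T ∈ N.localAlgebra a) :
    IsEquivariant a T := by
  refine closure_minimal ?_ (IsEquivariant.isClosed a) hT
  intro S hS
  induction hS using NonUnitalStarAlgebra.adjoin_induction with
  | mem x hx =>
    obtain ⟨p, hp⟩ := Set.mem_iUnion.1 hx
    exact .of_mem_strongClosure (fun S hS => N.isEquivariant_of_mem_span hS) hp
  | add x y _ _ hx hy => exact hx.add hy
  | zero => exact .zero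
  | mul x y _ _ hx hy => exact hx.mul hy
  | smul r x _ hx => exact hx.smul r
  | star x _ hx => exact hx.star

/-- The compressions of the span of the cycles of the class `p`. -/
noncomputable def compressedSpan (a : K) (p : LoopGroup a) :
    Submodule ℂ (LoopSpace H a →L[ℂ] LoopSpace H a) :=
  (Submodule.span ℂ (N.cycles a p)).map (compress a)

theorem one_mem_compressedSpan : 1 ∈ N.compressedSpan a 1 := by
  refine ⟨N.chiSeq (Seq.triv a), Submodule.subset_span ⟨Seq.triv a, rfl, rfl⟩, ?_⟩
  have e : N.chiSeq (Seq.triv a) = summandProj H a := by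
    change star (N.chi (le_refl a)) = _
    rw [N.chi_refl, star_summandProj]
  refine ContinuousLinearMap.ext fun f => ?_
  rw [compress_apply, e, loopEmb, summandProj_orbitIsometry]
  exact loopProj_loopEmb _ f

theorem mul_mem_compressedSpan {p q : LoopGroup a} {S T : LoopSpace H a →L[ℂ] LoopSpace H a}
    (hS : S ∈ N.compressedSpan a p) (hT : T ∈ N.compressedSpan a q) :
    S * T ∈ N.compressedSpan a (p * q) := by
  obtain ⟨S, hS, rfl⟩ := hS
  obtain ⟨T, hT, rfl⟩ := hT
  exact ⟨S * T, N.span_mul hS hT,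
    IsEquivariant.compress_mul S (N.isEquivariant_of_mem_span hT)⟩

theorem star_mem_compressedSpan {p : LoopGroup a} {S : LoopSpace H a →L[ℂ] LoopSpace H a}
    (hS : S ∈ N.compressedSpan a p) : star S ∈ N.compressedSpan a p⁻¹ := by
  obtain ⟨S, hS, rfl⟩ := hS
  exact ⟨star S, N.span_star hS, compress_star S⟩

theorem intertwines_compress {p : LoopGroup a} {T : Op H} (hT : T ∈ N.gradedPart a p) :
    Intertwines (N.compressedSpan a p : Set _) (compress a T) := by
  intro Q Q' h
  refine ContinuousLinearMap.ext fun x => ?_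
  exact eq_of_mem_strongClosure (ι := Unit) (κ := Unit) (A := fun _ => loopProj H (.base a))
    (v := fun _ _ => loopEmb H (.base a) (Q x)) (B := fun _ => Q' ∘L loopProj H (.base a))
    (w := fun _ _ => loopEmb H (.base a) x)
    (fun S hS _ _ => congrArg (fun R : LoopSpace H a →L[ℂ] LoopSpace H a => R x)
      (h _ ⟨S, hS, rfl⟩)) hT () ()

/-- Amplifications of compressions of elements of `𝔄_{a,p}` are strong limits of amplifications of
compressions of linear combinations of cycles. -/
theorem amplify_compress_mem_strongClosure {p : LoopGroup a} {T : Op H}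
    (hT : T ∈ N.gradedPart a p) (Y : Type*) :
    amplify (LoopSpace H a) Y (compress a T)
      ∈ strongClosure (amplify (LoopSpace H a) Y '' N.compressedSpan a p) := by
  refine (N.intertwines_compress hT).amplify_mem_strongClosure (s₀ := N.compressedSpan a 1)
    N.one_mem_compressedSpan (fun S hS R hR => ?_) (fun S hS R hR => ?_) Y
  · simpa using N.mul_mem_compressedSpan hS hR
  · simpa using N.mul_mem_compressedSpan (N.star_mem_compressedSpan hS) hR

/-! ### Compatibility with the embeddings of the net -/

/-- Transport of loops along `q`: the operator `x ⊗ e_g ↦ C_q x ⊗ e_{q * g * q⁻¹}`, where `C_q` is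
the coefficient of `χ_q`. -/
noncomputable def transport {a b : K} (q : Seq a b) : LoopSpace H a →L[ℂ] LoopSpace H b :=
  loopProj H (.base b) ∘L N.chiSeq q ∘L
    (loopEmb H ((PathsTo.base b).act q.cls.inv)).toContinuousLinearMap

theorem transport_single {a b : K} (q : Seq a b) (g : Path a a) (x : H a) :
    N.transport q (lp.single 2 g x)
      = lp.single 2 ((q.cls.comp g).comp q.cls.inv) (N.coef q x) := by
  change loopProj H _ (N.chiSeq q (loopEmb H _ _)) = _
  rw [loopEmb_single, chiSeq_vec, ← PathsTo.act_comp, ← PathsTo.act_comp, loopProj_vec]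

/-- From `q * g * r = (q * g * q⁻¹) * (q * r)`: the orbit of `r` goes to the orbit of `q * r`, and
in these coordinates the operator does not depend on `r`. -/
theorem chiSeq_loopEmb_transport {a b : K} (q : Seq a b) (r : PathsTo a) (f : LoopSpace H a) :
    N.chiSeq q (loopEmb H r f) = loopEmb H (r.act q.cls) (N.transport q f) := by
  have e : N.chiSeq q ∘L (loopEmb H r).toContinuousLinearMap
      = (loopEmb H (r.act q.cls)).toContinuousLinearMap ∘L N.transport q := lp_ext fun g x => by
    change N.chiSeq q (loopEmb H r (lp.single 2 g x))
      = loopEmb H (r.act q.cls) (N.transport q (lp.single 2 g x))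
    rw [transport_single, loopEmb_single, loopEmb_single, chiSeq_vec, ← PathsTo.act_comp,
      ← PathsTo.act_comp, Path.comp_assoc _ _ q.cls, Path.inv_comp, Path.comp_triv]
  exact congrArg (fun R : LoopSpace H a →L[ℂ] TotalSpace H => R f) e

theorem compress_conj {a b : K} (q : Seq a b) {T : Op H} (hT : IsEquivariant a T) :
    compress b (N.chiSeq q * T * N.chiSeq q.inv)
      = N.transport q ∘L compress a T ∘L N.transport q.inv := by
  ext1 f
  rw [compress_apply]
  change loopProj H _ (N.chiSeq q (T (N.chiSeq q.inv (loopEmb H _ f)))) = _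
  have e : ((PathsTo.base b).act q.inv.cls).act q.cls = PathsTo.base b := by
    rw [← PathsTo.act_comp, show q.inv.cls = q.cls.inv from rfl, Path.comp_inv, PathsTo.act_triv]
  rw [chiSeq_loopEmb_transport, hT.apply_emb, chiSeq_loopEmb_transport, e, loopProj_loopEmb]
  rfl

end HilbertNet

/-- Right multiplication by `g` on `H_a ⊗ l²(G_a)`. -/
noncomputable def rightMul (H : K → Type v) [∀ a, NormedAddCommGroup (H a)]
    [∀ a, InnerProductSpace ℂ (H a)] [∀ a, CompleteSpace (H a)] {a : K} (g : Path a a) :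
    LoopSpace H a →L[ℂ] LoopSpace H a :=
  loopProj H (.base a) ∘L (loopEmb H ((PathsTo.base a).act g)).toContinuousLinearMap

theorem rightMul_single {a : K} (g k : Path a a) (x : H a) :
    rightMul H g (lp.single 2 k x) = lp.single 2 (k.comp g) x := by
  change loopProj H _ (loopEmb H _ _) = _
  rw [loopEmb_single, ← PathsTo.act_comp, loopProj_vec]

/-- Right multiplication by `g` compares the parametrizations of one orbit from two of its points,
and `T` looks the same in both. This makes the later construction independent of the chosen orbit
representatives. -/
theorem IsEquivariant.compress_rightMul {a : K} {T : Op H} (hT : IsEquivariant a T)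
    (g : Path a a) (f : LoopSpace H a) :
    compress a T (rightMul H g f) = rightMul H g (compress a T f) := by
  change compress a T (loopProj H _ (loopEmb H _ f)) = loopProj H _ (loopEmb H _ _)
  rw [← hT.proj_apply, hT.apply_emb]

/-- Faithfulness of the compression: every `h ⊗ e_s` with `s ∈ S_a` lies in the orbit subspace based
at `s`, where the action is given by the compression. -/
theorem IsEquivariant.ext_compress {a : K} {S T : Op H} (hS : IsEquivariant a S)
    (hT : IsEquivariant a T) (hS' : S * HilbertNet.summandProj H a = S)
    (hT' : T * HilbertNet.summandProj H a = T) (h : compress a S = compress a T) : S = T := by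
  refine summand_ext hS' hT' fun s x => ?_
  have e : vec H s x = loopEmb H s (lp.single 2 (Seq.triv a).cls x) := by
    rw [loopEmb_single, PathsTo.act_triv]
  rw [e, hS.apply_emb, hT.apply_emb, h]

end Compression

/-! ### The induced morphism -/

namespace HilbertNet.Hom

variable {K : Type u} [PartialOrder K] {H : K → Type v}
  [∀ a, NormedAddCommGroup (H a)] [∀ a, InnerProductSpace ℂ (H a)] [∀ a, CompleteSpace (H a)]
  {L : Type u'} [PartialOrder L] {H' : L → Type v'}
  [∀ x, NormedAddCommGroup (H' x)] [∀ x, InnerProductSpace ℂ (H' x)] [∀ x, CompleteSpace (H' x)]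
  {N : HilbertNet K H} {M : HilbertNet L H'} (F : Hom N M)

/-- Surjectivity of `Φ_a` is essential: the identity is tested against vectors of `H'_{φ(a)}`, all
of which must come from `H_a`. -/
theorem adjoint_comm (hiso : ∀ a, Function.Surjective (F.Φ_ a)) {a b : K} (h : a ≤ b) (y : H b) :
    F.Φ_ a (ContinuousLinearMap.adjoint (N.γ h).toContinuousLinearMap y)
      = ContinuousLinearMap.adjoint (M.γ (F.φ.monotone h)).toContinuousLinearMap (F.Φ_ b y) := by
  refine ext_inner_left ℂ fun z => ?_
  obtain ⟨z, rfl⟩ := hiso a z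
  rw [LinearIsometry.inner_map_map, ContinuousLinearMap.adjoint_inner_right,
    ContinuousLinearMap.adjoint_inner_right]
  change ⟪N.γ h z, y⟫_ℂ = ⟪M.γ _ (F.Φ_ a z), F.Φ_ b y⟫_ℂ
  rw [← F.comm, LinearIsometry.inner_map_map]

theorem coef_comm (hiso : ∀ a, Function.Surjective (F.Φ_ a)) {a b : K} (q : Seq a b) (x : H a) :
    F.Φ_ b (N.coef q x) = M.coef (q.map F.φ) (F.Φ_ a x) := by
  have key {a b : K} (s : Elem a b) (x : H a) :
      F.Φ_ b (N.coefElem s x) = M.coef ((Seq.single s).map F.φ) (F.Φ_ a x) := by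
    cases s with
    | down h => exact F.adjoint_comm hiso h x
    | up h => exact F.comm h x
  induction q with
  | single s => exact key s x
  | cons s q ih =>
    refine (key s (N.coef q x)).trans ?_
    rw [ih]
    cases s <;> rfl

/-! ### Orbits of `φ*(G_a)` in `S_{φ(a)}` and amplification along them. -/

section Fibre

variable {a : K} (ha : Function.Injective fun p : Path a a => p.map F.φ)

include ha in
-- Injectivity of `φ*` on loops at `a` makes the action of `G_a` on `S_{φ(a)}` free.
theorem act_map_injective (x : PathsTo (F.φ a)) :
    Function.Injective fun g : Path a a => x.act (g.map F.φ) :=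
  fun _ _ h => ha (PathsTo.act_left_injective x h)

/-- The isometry `H_a ⊗ l²(G_a) → H'_{φ(a)} ⊗ l²(S_{φ(a)})`, `h ⊗ e_g ↦ Φ_a(h) ⊗ e_{φ(g) * x}`. -/
noncomputable def orbitEmb (x : PathsTo (F.φ a)) : LoopSpace H a →ₗᵢ[ℂ] TotalSpace H' :=
  orbitIsometry (F.act_map_injective ha x) (F.Φ_ a)

theorem orbitEmb_single (x : PathsTo (F.φ a)) (g : Path a a) (h : H a) :
    F.orbitEmb ha x (lp.single 2 g h) = vec H' (x.act (g.map F.φ)) (F.Φ_ a h) :=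
  orbitIsometry_single _ _ g h

theorem orbitEmb_act (x : PathsTo (F.φ a)) (g : Path a a) (f : LoopSpace H a) :
    F.orbitEmb ha (x.act (g.map F.φ)) f = F.orbitEmb ha x (rightMul H g f) := by
  have e : (F.orbitEmb ha (x.act (g.map F.φ))).toContinuousLinearMap
      = (F.orbitEmb ha x).toContinuousLinearMap ∘L rightMul H g := lp_ext fun k h => by
    change F.orbitEmb ha (x.act (g.map F.φ)) (lp.single 2 k h)
      = F.orbitEmb ha x (rightMul H g (lp.single 2 k h))
    rw [rightMul_single, orbitEmb_single, orbitEmb_single, Path.map_comp, PathsTo.act_comp]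
  exact congrArg (fun R : LoopSpace H a →L[ℂ] TotalSpace H' => R f) e

theorem chiSeq_orbitEmb (hiso : ∀ a, Function.Surjective (F.Φ_ a)) (q : Seq a a)
    (x : PathsTo (F.φ a)) (f : LoopSpace H a) :
    M.chiSeq (q.map F.φ) (F.orbitEmb ha x f)
      = F.orbitEmb ha x (compress a (N.chiSeq q) f) := by
  have e : M.chiSeq (q.map F.φ) ∘L (F.orbitEmb ha x).toContinuousLinearMap
      = (F.orbitEmb ha x).toContinuousLinearMap ∘L compress a (N.chiSeq q) := lp_ext fun g h => by
    change M.chiSeq (q.map F.φ) (F.orbitEmb ha x (lp.single 2 g h))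
      = F.orbitEmb ha x (compress a (N.chiSeq q) (lp.single 2 g h))
    rw [compress_chiSeq_single, orbitEmb_single, orbitEmb_single, chiSeq_vec, Path.map_comp,
      PathsTo.act_comp, F.coef_comm hiso]
    rfl
  exact congrArg (fun R : LoopSpace H a →L[ℂ] TotalSpace H' => R f) e

/-- The counterpart in `L` of `chiSeq_loopEmb_transport`. The same transport operator of `K` occurs
because `φ` respects conjugation of loops by `q` and `Φ` intertwines the coefficients. -/
theorem chiSeq_orbitEmb_transport (hiso : ∀ a, Function.Surjective (F.Φ_ a)) {b : K}
    (hb : Function.Injective fun p : Path b b => p.map F.φ) (q : Seq a b)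
    (x : PathsTo (F.φ a)) (f : LoopSpace H a) :
    M.chiSeq (q.map F.φ) (F.orbitEmb ha x f)
      = F.orbitEmb hb (x.act (q.map F.φ).cls) (N.transport q f) := by
  have e : M.chiSeq (q.map F.φ) ∘L (F.orbitEmb ha x).toContinuousLinearMap
      = (F.orbitEmb hb (x.act (q.map F.φ).cls)).toContinuousLinearMap ∘L N.transport q :=
    lp_ext fun g h => by
      change M.chiSeq (q.map F.φ) (F.orbitEmb ha x (lp.single 2 g h))
        = F.orbitEmb hb (x.act (q.map F.φ).cls) (N.transport q (lp.single 2 g h))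
      have e' : (((q.cls.comp g).comp q.cls.inv).map F.φ).comp (q.map F.φ).cls
          = (q.map F.φ).cls.comp (g.map F.φ) := by
        change Path.comp _ (q.cls.map F.φ) = (q.cls.map F.φ).comp _
        rw [← Path.map_comp, ← Path.map_comp, Path.comp_assoc _ _ q.cls, Path.inv_comp,
          Path.comp_triv]
      rw [transport_single, orbitEmb_single, orbitEmb_single, chiSeq_vec, ← PathsTo.act_comp,
        ← PathsTo.act_comp, F.coef_comm hiso, e']
  exact congrArg (fun R : LoopSpace H a →L[ℂ] TotalSpace H' => R f) e

/-- The equivalence relation on `S_{φ(a)}` of being in the same orbit of `φ*(G_a)`. -/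
def orbitSetoid (a : K) : Setoid (PathsTo (F.φ a)) where
  r s t := ∃ g : Path a a, s.act (g.map F.φ) = t
  iseqv :=
    { refl := fun s => ⟨(Seq.triv a).cls, PathsTo.act_triv s⟩
      symm := by
        rintro s _ ⟨g, rfl⟩
        refine ⟨g.inv, ?_⟩
        rw [← PathsTo.act_comp, ← Path.map_comp, Path.inv_comp]
        exact PathsTo.act_triv s
      trans := by
        rintro s _ _ ⟨g, rfl⟩ ⟨k, rfl⟩
        exact ⟨k.comp g, by rw [Path.map_comp, PathsTo.act_comp]⟩ }

/-- The orbits of `φ*(G_a)` in `S_{φ(a)}`. -/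
abbrev Orbits (a : K) : Type u' := Quotient (F.orbitSetoid a)

theorem orthogonalFamily_orbitEmb :
    OrthogonalFamily ℂ (fun _ : F.Orbits a => LoopSpace H a) fun i => F.orbitEmb ha i.out := by
  intro i j hij f f'
  refine inner_orbitIsometry_of_disjoint _ _ _ _ (fun g g' h => hij ?_) f f'
  have h₁ : (F.orbitSetoid a) i.out (i.out.act (g.map F.φ)) := ⟨g, rfl⟩
  have h₂ : (F.orbitSetoid a) j.out (j.out.act (g'.map F.φ)) := ⟨g', rfl⟩
  rw [h] at h₁
  rw [← i.out_eq, ← j.out_eq]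
  exact Quotient.sound ((F.orbitSetoid a).trans h₁ ((F.orbitSetoid a).symm h₂))

/-- The decomposition of `H'_{φ(a)} ⊗ l²(S_{φ(a)})` into the orbits of `φ*(G_a)`. -/
noncomputable def orbitSum :
    lp (fun _ : F.Orbits a => LoopSpace H a) 2 →ₗᵢ[ℂ] TotalSpace H' :=
  (F.orthogonalFamily_orbitEmb ha).linearIsometry

theorem orbitSum_single (i : F.Orbits a) (f : LoopSpace H a) :
    F.orbitSum ha (lp.single 2 i f) = F.orbitEmb ha i.out f :=
  (F.orthogonalFamily_orbitEmb ha).linearIsometry_apply_single f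

theorem summandProj_orbitSum (f : lp (fun _ : F.Orbits a => LoopSpace H a) 2) :
    summandProj H' (F.φ a) (F.orbitSum ha f) = F.orbitSum ha f := by
  have e : summandProj H' (F.φ a) ∘L (F.orbitSum ha).toContinuousLinearMap
      = (F.orbitSum ha).toContinuousLinearMap := lp_ext fun i f => by
    change summandProj H' (F.φ a) (F.orbitSum ha (lp.single 2 i f))
      = F.orbitSum ha (lp.single 2 i f)
    rw [orbitSum_single]
    exact summandProj_orbitIsometry _ _ f
  exact congrArg (fun R : _ →L[ℂ] TotalSpace H' => R f) e

/-- The adjoint of `orbitSum`. -/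
noncomputable def orbitProj : TotalSpace H' →L[ℂ] lp (fun _ : F.Orbits a => LoopSpace H a) 2 :=
  ContinuousLinearMap.adjoint (F.orbitSum ha).toContinuousLinearMap

theorem orbitProj_orbitSum (f : lp (fun _ : F.Orbits a => LoopSpace H a) 2) :
    F.orbitProj ha (F.orbitSum ha f) = f := adjoint_apply_self _ f

theorem orbitProj_summandProj (v : TotalSpace H') :
    F.orbitProj ha (summandProj H' (F.φ a) v) = F.orbitProj ha v := by
  refine ext_inner_right ℂ fun f => ?_
  rw [orbitProj, ContinuousLinearMap.adjoint_inner_left, ContinuousLinearMap.adjoint_inner_left,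
    ← ContinuousLinearMap.adjoint_inner_right, ← ContinuousLinearMap.star_eq_adjoint,
    star_summandProj]
  exact congrArg (inner ℂ v) (F.summandProj_orbitSum ha f)

/-- The amplification of an operator on `H_a ⊗ l²(G_a)` to an operator on
`H'_{φ(a)} ⊗ l²(S_{φ(a)})`. -/
noncomputable def spread : (LoopSpace H a →L[ℂ] LoopSpace H a) →⋆ₙₐ[ℂ] Op H' :=
  (conjIsometry (F.orbitSum ha)).comp
    (amplify (LoopSpace H a) (F.Orbits a)).toNonUnitalStarAlgHom

theorem spread_apply (T : LoopSpace H a →L[ℂ] LoopSpace H a) (v : TotalSpace H') :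
    F.spread ha T v = F.orbitSum ha (amplify (LoopSpace H a) (F.Orbits a) T (F.orbitProj ha v)) := rfl

theorem norm_spread_le (T : LoopSpace H a →L[ℂ] LoopSpace H a) : ‖F.spread ha T‖ ≤ ‖T‖ :=
  (norm_conjIsometry_le _ _).trans (norm_amplify_le T)

theorem spread_orbitEmb_out (T : LoopSpace H a →L[ℂ] LoopSpace H a) (i : F.Orbits a)
    (f : LoopSpace H a) : F.spread ha T (F.orbitEmb ha i.out f) = F.orbitEmb ha i.out (T f) := by
  rw [← orbitSum_single, ← orbitSum_single, spread_apply, orbitProj_orbitSum, amplify_single]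

theorem spread_mul_summandProj (T : LoopSpace H a →L[ℂ] LoopSpace H a) :
    F.spread ha T * summandProj H' (F.φ a) = F.spread ha T :=
  ContinuousLinearMap.ext fun v =>
    congrArg (fun w => F.orbitSum ha (amplify (LoopSpace H a) (F.Orbits a) T w)) (F.orbitProj_summandProj ha v)

/-- There is at least one orbit, that of the trivial path, and the operator can be recovered from
its action there. -/
theorem spread_injective : Function.Injective (F.spread ha) := by
  intro S T h
  ext1 f
  let i : F.Orbits a := Quotient.mk _ (PathsTo.base (F.φ a))
  have h' := congrArg (fun R : Op H' => R (F.orbitEmb ha i.out f)) h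
  simp only [spread_orbitEmb_out] at h'
  exact (F.orbitEmb ha i.out).injective h'

theorem exists_out_act (x : PathsTo (F.φ a)) :
    ∃ (i : F.Orbits a) (g : Path a a), i.out.act (g.map F.φ) = x :=
  ⟨Quotient.mk _ x, Quotient.mk_out (s := F.orbitSetoid a) x⟩

/-- By construction this holds at the chosen representatives. Passing to another point of the orbit
is a right multiplication, which commutes with the compression of `T`. -/
theorem spread_compress_orbitEmb {T : Op H} (hT : IsEquivariant a T) (x : PathsTo (F.φ a))
    (f : LoopSpace H a) :
    F.spread ha (compress a T) (F.orbitEmb ha x f) = F.orbitEmb ha x (compress a T f) := by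
  obtain ⟨i, g, rfl⟩ := F.exists_out_act x
  rw [orbitEmb_act, orbitEmb_act, spread_orbitEmb_out, hT.compress_rightMul]

/-- An operator on the summand at `φ(a)` that acts as `T` on every orbit is the amplification
of `T`. -/
theorem eq_spread (hiso : ∀ a, Function.Surjective (F.Φ_ a))
    {T : LoopSpace H a →L[ℂ] LoopSpace H a} {S : Op H'}
    (hS : S * summandProj H' (F.φ a) = S)
    (h : ∀ (x : PathsTo (F.φ a)) (f : LoopSpace H a),
      S (F.orbitEmb ha x f) = F.orbitEmb ha x (T f)) : S = F.spread ha T := by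
  refine summand_ext hS (F.spread_mul_summandProj ha T) fun s y => ?_
  obtain ⟨i, g, rfl⟩ := F.exists_out_act s
  obtain ⟨y, rfl⟩ := hiso a y
  rw [← F.orbitEmb_single ha, h, spread_orbitEmb_out]

theorem spread_compress_chiSeq (hiso : ∀ a, Function.Surjective (F.Φ_ a)) (q : Seq a a) :
    F.spread ha (compress a (N.chiSeq q)) = M.chiSeq (q.map F.φ) :=
  (F.eq_spread ha hiso (M.chiSeq_mul_summandProj _) (F.chiSeq_orbitEmb ha hiso q)).symm

/-- By the uniqueness in `eq_spread` it suffices to follow one orbit of `φ*(G_b)`: `q.inv` carries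
it to an orbit of `φ*(G_a)`, the amplification acts there, and `q` brings it back. This is the
computation of `compress_conj`. -/
theorem spread_conj (hiso : ∀ a, Function.Surjective (F.Φ_ a)) {b : K}
    (hb : Function.Injective fun p : Path b b => p.map F.φ) (q : Seq a b) {T : Op H}
    (hT : IsEquivariant a T) :
    F.spread hb (compress b (N.chiSeq q * T * N.chiSeq q.inv))
      = M.chiSeq (q.map F.φ) * F.spread ha (compress a T) * M.chiSeq (q.inv.map F.φ) := by
  refine (F.eq_spread hb hiso ?_ fun x f => ?_).symm
  · rw [mul_assoc, M.chiSeq_mul_summandProj]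
  · have e : (x.act (q.inv.map F.φ).cls).act (q.map F.φ).cls = x := by
      rw [← PathsTo.act_comp]
      change x.act ((q.cls.map F.φ).comp (q.cls.inv.map F.φ)) = x
      rw [← Path.map_comp, Path.comp_inv]
      exact PathsTo.act_triv x
    change M.chiSeq (q.map F.φ) (F.spread ha (compress a T)
      (M.chiSeq (q.inv.map F.φ) (F.orbitEmb hb x f))) = _
    rw [F.chiSeq_orbitEmb_transport hb hiso ha, F.spread_compress_orbitEmb ha hT,
      F.chiSeq_orbitEmb_transport ha hiso hb, e, N.compress_conj q hT]
    rfl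

theorem spread_mem_span (hiso : ∀ a, Function.Surjective (F.Φ_ a)) {p : LoopGroup a}
    {T : LoopSpace H a →L[ℂ] LoopSpace H a} (hT : T ∈ N.compressedSpan a p) :
    F.spread ha T ∈ Submodule.span ℂ (M.cycles (F.φ a) (piOneMap F.φ a p)) := by
  obtain ⟨S, hS, rfl⟩ := hT
  induction hS using Submodule.span_induction with
  | mem x hx =>
    obtain ⟨q, rfl, rfl⟩ := hx
    rw [F.spread_compress_chiSeq ha hiso]
    exact Submodule.subset_span ⟨q.map F.φ, rfl, rfl⟩
  | zero => rw [map_zero, map_zero]; exact zero_mem _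
  | add x y _ _ hx hy => rw [map_add, map_add]; exact add_mem hx hy
  | smul c x _ hx => rw [map_smul, map_smul]; exact Submodule.smul_mem _ _ hx

/-- The density theorem supplies combinations of cycles whose amplifications approximate at the
finitely many vectors `orbitProj v`. Conjugation by the isometry `orbitSum` preserves the errors,
and `spread` turns these combinations into combinations of cycles in `L`. -/
theorem spread_compress_mem_gradedPart (hiso : ∀ a, Function.Surjective (F.Φ_ a))
    {p : LoopGroup a} {T : Op H} (hT : T ∈ N.gradedPart a p) :
    F.spread ha (compress a T) ∈ M.gradedPart (F.φ a) (piOneMap F.φ a p) := by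
  obtain ⟨l, hl, hs, ht⟩ :=
    exists_filter_of_mem_strongClosure (N.amplify_compress_mem_strongClosure hT (F.Orbits a))
  refine mem_strongClosure_of_forall_finite fun t ε hε => ?_
  have h : ∀ᶠ S in l, ∀ v ∈ t,
      ‖S (F.orbitProj ha v) - amplify (LoopSpace H a) (F.Orbits a) (compress a T) (F.orbitProj ha v)‖ < ε := by
    rw [Filter.eventually_all_finset]
    intro v _
    have := Metric.tendsto_nhds.1 (ht (F.orbitProj ha v)) ε hε
    simpa only [dist_eq_norm] using this
  obtain ⟨_, ⟨S, hS, rfl⟩, h⟩ := (hs.and h).exists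
  refine ⟨F.spread ha S, F.spread_mem_span ha hiso hS, fun v hv => ?_⟩
  rw [spread_apply, spread_apply, ← map_sub, LinearIsometry.norm_map]
  exact h v hv

theorem spread_compress_mem_localAlgebra (hiso : ∀ a, Function.Surjective (F.Φ_ a))
    {T : Op H} (hT : T ∈ N.localAlgebra a) :
    F.spread ha (compress a T) ∈ M.localAlgebra (F.φ a) := by
  have hcl : IsClosed (M.localAlgebra (F.φ a) : Set (Op H')) := inferInstance
  have hcont : Continuous fun T : Op H => F.spread ha (compress a T) :=
    (AddMonoidHomClass.continuous_of_bound (F.spread ha) 1 fun T => by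
      rw [one_mul]; exact F.norm_spread_le ha T).comp (continuous_compress a)
  refine closure_minimal ?_ (hcl.preimage hcont) hT
  intro S hS
  change F.spread ha (compress a S) ∈ M.localAlgebra (F.φ a)
  induction hS using NonUnitalStarAlgebra.adjoin_induction with
  | mem x hx =>
    obtain ⟨p, hp⟩ := Set.mem_iUnion.1 hx
    exact M.gradedPart_subset_localAlgebra _ _ (F.spread_compress_mem_gradedPart ha hiso hp)
  | add x y _ _ hx hy => rw [map_add, map_add]; exact add_mem hx hy
  | zero => rw [map_zero, map_zero]; exact zero_mem _
  | mul x y _ hy' hx hy =>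
    -- Compression is multiplicative only for equivariant right factors, so `y` is first placed in
    -- the local algebra.
    rw [(N.isEquivariant_of_mem_localAlgebra
      (NonUnitalStarSubalgebra.le_topologicalClosure _ hy')).compress_mul, map_mul]
    exact mul_mem hx hy
  | smul r x _ hx => rw [map_smul, map_smul]; exact SMulMemClass.smul_mem r hx
  | star x _ hx => rw [compress_star, map_star]; exact star_mem hx

/-- The `*`-homomorphism `Φ*_a : 𝔄_a → 𝔄_{φ(a)}`. -/
noncomputable def localHom (hiso : ∀ a, Function.Surjective (F.Φ_ a)) :
    N.localAlgebra a →⋆ₙₐ[ℂ] M.localAlgebra (F.φ a) where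
  toFun T := ⟨F.spread ha (compress a T), F.spread_compress_mem_localAlgebra ha hiso T.2⟩
  map_smul' c T := Subtype.ext (by
    change F.spread ha (compress a (c • (T : Op H))) = c • F.spread ha (compress a T)
    rw [map_smul, map_smul])
  map_zero' := Subtype.ext (by
    change F.spread ha (compress a 0) = 0
    rw [map_zero, map_zero])
  map_add' S T := Subtype.ext (by
    change F.spread ha (compress a (S + T : Op H)) = _
    rw [map_add, map_add]; rfl)
  map_mul' S T := Subtype.ext (by
    change F.spread ha (compress a (S * T : Op H)) = _
    rw [(N.isEquivariant_of_mem_localAlgebra T.2).compress_mul, map_mul]; rfl)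
  map_star' T := Subtype.ext (by
    change F.spread ha (compress a (star (T : Op H))) = _
    rw [compress_star, map_star]; rfl)

theorem localHom_injective (hiso : ∀ a, Function.Surjective (F.Φ_ a)) :
    Function.Injective (F.localHom ha hiso) := by
  intro S T h
  exact Subtype.ext ((N.isEquivariant_of_mem_localAlgebra S.2).ext_compress
    (N.isEquivariant_of_mem_localAlgebra T.2) (N.localAlgebra_corner S.2).2
    (N.localAlgebra_corner T.2).2 (F.spread_injective ha (congrArg Subtype.val h)))

end Fibre

end HilbertNet.Hom

end PosetNet

theorem mainTheorem7 {K : Type u} [PartialOrder K] {L : Type u'} [PartialOrder L]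
    {H : K → Type v} [∀ a, NormedAddCommGroup (H a)] [∀ a, InnerProductSpace ℂ (H a)]
    [∀ a, CompleteSpace (H a)]
    {H' : L → Type v'} [∀ x, NormedAddCommGroup (H' x)] [∀ x, InnerProductSpace ℂ (H' x)]
    [∀ x, CompleteSpace (H' x)]
    (N : PosetNet.HilbertNet K H) (M : PosetNet.HilbertNet L H')
    (F : PosetNet.HilbertNet.Hom N M)
    (hK : PosetNet.PathConnected K)
    (hiso : ∀ a : K, Function.Surjective (F.Φ_ a))
    (a₀ : K) (hinj : Function.Injective (PosetNet.piOneMap F.φ a₀)) :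
    ∃ Ψ : PosetNet.CStarNet.Hom F.φ N.localNet M.localNet,
      Ψ.IsFaithful ∧
      -- `Φ*_a` sends the cycle of a loop `p` at `a` to the cycle of `φ(p)`
      (∀ (a : K) (p : PosetNet.Seq a a),
        ((Ψ.Φ a ⟨N.chiSeq p, N.chiSeq_mem_localAlgebra p⟩ : M.localAlgebra (F.φ a)) :
          PosetNet.Op H') = M.chiSeq (p.map F.φ)) ∧
      -- `Φ*_a` preserves the grading
      (∀ (a : K) (p : PosetNet.LoopGroup a) (A : N.localAlgebra a),
        (A : PosetNet.Op H) ∈ N.gradedPart a p →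
        ((Ψ.Φ a A : M.localAlgebra (F.φ a)) : PosetNet.Op H') ∈
          M.gradedPart (F.φ a) (PosetNet.piOneMap F.φ a p)) ∧
      -- `Φ*_a` is strongly continuous on bounded subsets of each graded component
      (∀ (a : K) (p : PosetNet.LoopGroup a) (r : ℝ) (l : Filter (N.localAlgebra a))
        (A : N.localAlgebra a),
        (∀ᶠ T : N.localAlgebra a in l, (T : PosetNet.Op H) ∈ N.gradedPart a p ∧ ‖T‖ ≤ r) →
        (∀ f : PosetNet.TotalSpace H,
          Filter.Tendsto (fun T : N.localAlgebra a => (T : PosetNet.Op H) f) l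
            (𝓝 ((A : PosetNet.Op H) f))) →
        ∀ g : PosetNet.TotalSpace H',
          Filter.Tendsto (fun T : N.localAlgebra a =>
            ((Ψ.Φ a T : M.localAlgebra (F.φ a)) : PosetNet.Op H') g) l
            (𝓝 (((Ψ.Φ a A : M.localAlgebra (F.φ a)) : PosetNet.Op H') g))) := by
  -- Path connectedness carries injectivity from the base point `a₀` to every `a`.
  have hinj' (a : K) : Function.Injective fun p : PosetNet.Path a a => p.map F.φ :=
    (hK a₀ a).elim fun r => PosetNet.Path.map_injective_of_path F.φ r hinj
  refine ⟨⟨fun a => F.localHom (hinj' a) hiso, fun {a b} h T => Subtype.ext ?_⟩,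
    fun a => F.localHom_injective (hinj' a) hiso,
    fun a p => F.spread_compress_chiSeq (hinj' a) hiso p,
    fun a p A hA => F.spread_compress_mem_gradedPart (hinj' a) hiso hA, ?_⟩
  -- The embedding `α_{ba}` is conjugation by the cycle operator of the sequence `up h`, whose
  -- adjoint belongs to the reverse sequence.
  · exact F.spread_conj (hinj' a) hiso (hinj' b) (PosetNet.Seq.up h)
      (N.isEquivariant_of_mem_localAlgebra T.2)
  · intro a p r l A hl hA g
    -- Compression preserves both the norm bound and strong convergence, so bounded strong
    -- continuity of the amplification applies.
    refine ((F.orbitSum (hinj' a)).continuous.tendsto _).comp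
      (PosetNet.tendsto_amplify (r := r) (hl.mono fun T hT => ?_) (fun f => ?_) _)
    · exact (PosetNet.norm_compress_le _).trans hT.2
    · exact ((PosetNet.loopProj H (.base a)).continuous.tendsto _).comp (hA _)
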